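/- Fix an integer $n\ge 1$ and put $\alpha=\pi/(2n+1)$. Let $V$ be the space of affine linear functions $f(x)=\langle a,x\rangle+b$ on the Euclidean plane $\mathbb{E}^2$, with the symmetric bilinear form $(f,g)=\langle a,c\rangle$ if $f(x)=\langle a,x\rangle+b$ and $g(x)=\langle c,x\rangle+e$. A seed $(\mathbf v,B)$ consists of a real skew-symmetric $3\times3$ matrix $B=(b_{ij})$, with quiver given by arrows $i\to j$ for $b_{ij}>0$, and an ordered basis $\mathbf v=(v_1,v_2,v_3)$ of $V$ such that $(v_i,v_i)=2$, $|(v_i,v_j)|=|b_{ij}|$ for $i\ne j$ and, if $(v_i,v_j)\neq0$ for all $i<j$, the number of pairs $i<j$ with $(v_i,v_j)>0$ is even if $B$ is acyclic and odd otherwise. The seed describes the region of the plane in which $v_1,v_2,v_3$ are all negative. Seeds which differ by a simultaneous reordering of the indices are identified, and for $w\in\mathbb{E}^2$ the seed $w+(\mathbf v,B)$ is obtained by translating all $v_i$ by $w$ and keeping $B$. Given a notion of positive vectors, the mutation of $(\mathbf v,B)$ at $k$ is $(\mathbf v',B')$, where $b'_{ij}=-b_{ij}$ if $k\in\{i,j\}$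 and $b'_{ij}=b_{ij}+(b_{ik}|b_{kj}|+|b_{ik}|b_{kj})/2$ otherwise; $v'_k=-v_k$; and, for $i\ne k$, $v_i'=v_i-(v_i,v_k)v_k$ if either $v_k$ is positive and $b_{ik}<0$, or $v_k$ is not positive and $b_{ik}>0$, and $v_i'=v_i$ in all other cases. The vertices of the exchange graph of a seed are the seeds obtained from it by finite sequences of mutations. Let $\Delta_0\subseteq\mathbb{E}^2$ be a triangle with angles $\alpha,n\alpha,n\alpha$, and let $d_1$ be the length of its two legs (its longer sides). Let $(\mathbf v_0,B_0)$ be the initial seed given by $\Delta_0$, each $v_i$ vanishing on one side and being negative on the interior, together with the acyclic quiver in which the base is the source, one leg is the sink, and there is an arrow from the other leg to the sink. Let $b$ be the line through the feet of the two altitudes of $\Delta_0$ on the source and on the sink. A vector $f\in V$ is called positive if the points of $b$ sufficiently far in the direction from the foot on the source to the foot on the sink all satisfy $f<0$ (the reference point lies infinitely far away on $b$ in this direction). Let $$R=\Big\langle\, d_1\frac{\sin(\alpha)\sin(n\alpha)}{\sin^2(k\alpha)} \;\Big|\; 1\le k\le n,\ \gcd(k,2n+1)=1\,\Big\rangle_{\mathbb{Z}}\subseteq\mathbb{R},$$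 and let $L\subseteq\mathbb{R}$ be the $\mathbb{Z}$-module spanned by the Euclidean lengths of all vectors $w\in\mathbb{E}^2$ such that the exchange graph of $(\mathbf v_0,B_0)$ contains two seeds $(\mathbf v_1,B_1)$ and $(\mathbf v_2,B_2)$ with $(\mathbf v_1,B_1)=w+(\mathbf v_2,B_2)$. 1. There exists an integer $d\geq 1$ such that $$R\subseteq L\subseteq \tfrac1d\mathbb{Z}[2\cos\alpha]\,d_1\qquad\text{and}\qquad R\subseteq\mathbb{Z}[2\cos\alpha]\,d_1\subseteq\tfrac1d\mathbb{Z}[2\cos\alpha]\,d_1 .$$ 2. The lattices $R$, $L$, $\mathbb{Z}[2\cos\alpha]\,d_1$ (and $\tfrac1d\mathbb{Z}[2\cos\alpha]\,d_1$) all have rank $\varphi(2n+1)/2$ over $\mathbb{Z}$, where $\varphi$ is Euler's totient function. -/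

import Mathlib

open Filter Topology

noncomputable section

namespace RealQuiver

/-- The Euclidean plane. -/
abbrev Plane : Type := EuclideanSpace ℝ (Fin 2)

/-- The three-dimensional space `V` of affine linear functions on the plane: the pair `(a, b)` is
the function `x ↦ ⟪a, x⟫ + b`. -/
abbrev AffFun : Type := Plane × ℝ

/-- The value of the affine linear function `f` at the point `x`. -/
def AffFun.eval (f : AffFun) (x : Plane) : ℝ := inner ℝ f.1 x + f.2

/-- The (degenerate) symmetric bilinear form on `V`: the inner product of the linear parts. -/
def form (f g : AffFun) : ℝ := inner ℝ f.1 g.1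

/-- The affine linear function translated by `w`: its value at `w + x` is the value of `f`
at `x`. -/
def AffFun.translate (w : Plane) (f : AffFun) : AffFun := (f.1, f.2 - inner ℝ f.1 w)

/-- The quiver of a skew-symmetric `3 × 3` matrix has an arrow `i → j` when `0 < B i j`. On three
vertices, without loops and `2`-cycles, an oriented cycle is an oriented triangle. -/
def IsAcyclic (B : Matrix (Fin 3) (Fin 3) ℝ) : Prop :=
  ¬ ∃ i j k, 0 < B i j ∧ 0 < B j k ∧ 0 < B k i

open Classical in
/-- An ordered basis `v` of `V` (three linearly independent vectors in a space of dimension three)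
is a geometric realisation of the skew-symmetric matrix `B`. -/
structure IsGeometricRealisation (v : Fin 3 → AffFun) (B : Matrix (Fin 3) (Fin 3) ℝ) : Prop where
  linearIndependent : LinearIndependent ℝ v
  form_self : ∀ i, form (v i) (v i) = 2
  abs_form : ∀ i j, i ≠ j → |form (v i) (v j)| = |B i j|
  parity : (∀ i j, i < j → form (v i) (v j) ≠ 0) →
    (Even (Finset.univ.filter
      (fun p : Fin 3 × Fin 3 => p.1 < p.2 ∧ 0 < form (v p.1) (v p.2))).card ↔ IsAcyclic B)

/-- A seed: a skew-symmetric real matrix together with a geometric realisation. -/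
@[ext]
structure Seed where
  v : Fin 3 → AffFun
  B : Matrix (Fin 3) (Fin 3) ℝ
  skew : B.transpose = -B
  realisation : IsGeometricRealisation v B

/-- Matrix mutation at `k`. -/
def mutateMatrix (B : Matrix (Fin 3) (Fin 3) ℝ) (k : Fin 3) : Matrix (Fin 3) (Fin 3) ℝ :=
  Matrix.of fun i j => if i = k ∨ j = k then -B i j
    else B i j + (B i k * |B k j| + |B i k| * B k j) / 2

open Classical in
/-- Mutation of the vectors at `k`, with respect to a set `Pos` of positive vectors. (If
`B i k = 0`, then `v i` is orthogonal to `v k` and is left unchanged.) -/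
def mutateVectors (Pos : AffFun → Prop) (v : Fin 3 → AffFun) (B : Matrix (Fin 3) (Fin 3) ℝ)
    (k : Fin 3) : Fin 3 → AffFun :=
  fun i => if i = k then -v i
    else if (Pos (v k) ∧ B i k < 0) ∨ (¬ Pos (v k) ∧ 0 < B i k) then
      v i - form (v i) (v k) • v k
    else v i

theorem mutateMatrix_skew {B : Matrix (Fin 3) (Fin 3) ℝ} (hB : B.transpose = -B) (k : Fin 3) :
    (mutateMatrix B k).transpose = -mutateMatrix B k := by
  have h : ∀ i j, B j i = -B i j := fun i j => congrFun (congrFun hB i) j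
  ext i j
  simp only [Matrix.transpose_apply, Matrix.neg_apply, mutateMatrix, Matrix.of_apply]
  by_cases hi : i = k
  · simp only [hi, or_true, true_or, if_true, h k j]
  · by_cases hj : j = k
    · simp only [hj, or_true, true_or, if_true, h i k]
    · simp only [hi, hj, or_self, if_false]
      rw [h i j, h k j, h i k, abs_neg, abs_neg]
      ring

/-- The oriented-triangle condition for three given arrows. -/
def Cyc (x y z : ℝ) : Prop := (0 < x ∧ 0 < y ∧ 0 < z) ∨ (x < 0 ∧ y < 0 ∧ z < 0)

theorem isAcyclic_iff {B : Matrix (Fin 3) (Fin 3) ℝ} (hB : B.transpose = -B) :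
    IsAcyclic B ↔ ¬ Cyc (B 0 1) (B 1 2) (B 2 0) := by
  have h : ∀ i j, B j i = -B i j := fun i j => congrFun (congrFun hB i) j
  have h00 : B 0 0 = 0 := by linarith [h 0 0]
  have h11 : B 1 1 = 0 := by linarith [h 1 1]
  have h22 : B 2 2 = 0 := by linarith [h 2 2]
  have h01 := h 0 1
  have h12 := h 1 2
  have h20 := h 2 0
  unfold IsAcyclic Cyc
  rw [not_iff_not]
  constructor
  · rintro ⟨i, j, k, h1, h2, h3⟩
    fin_cases i <;> fin_cases j <;> fin_cases k <;> simp only [Fin.zero_eta, Fin.mk_one,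
      Fin.reduceFinMk] at h1 h2 h3 <;>
    first
      | (exfalso; linarith)
      | (left; refine ⟨?_, ?_, ?_⟩ <;> linarith)
      | (right; refine ⟨?_, ?_, ?_⟩ <;> linarith)
  · rintro (⟨h1, h2, h3⟩ | ⟨h1, h2, h3⟩)
    · exact ⟨0, 1, 2, h1, h2, h3⟩
    · exact ⟨0, 2, 1, by linarith, by linarith, by linarith⟩

theorem core_same {a b c A P Q ci cj : ℝ} (ha : |a| = |A|)
    (hpar : a * b * c ≠ 0 → (a * b * c < 0 ↔ ¬ Cyc A Q (-P)))
    (hPQ : 0 < P * Q) (hc : (ci = b ∧ cj = c) ∨ (ci = 0 ∧ cj = 0)) :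
    |a - cj * b - ci * c + 2 * ci * cj| = |A + (P * |Q| - |P| * Q) / 2| ∧
    ((a - cj * b - ci * c + 2 * ci * cj) * (2 * ci - b) * (2 * cj - c) ≠ 0 →
     ((a - cj * b - ci * c + 2 * ci * cj) * (2 * ci - b) * (2 * cj - c) < 0 ↔
       ¬ Cyc (A + (P * |Q| - |P| * Q) / 2) (-Q) P)) := by
  have e1 : P * |Q| - |P| * Q = 0 := by
    rcases pos_and_pos_or_neg_and_neg_of_mul_pos hPQ with ⟨h, h'⟩ | ⟨h, h'⟩
    · rw [abs_of_pos h, abs_of_pos h']; ring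
    · rw [abs_of_neg h, abs_of_neg h']; ring
  have n1 : ∀ x : ℝ, ¬ Cyc x Q (-P) := by
    rintro x (⟨-, h, h'⟩ | ⟨-, h, h'⟩) <;> nlinarith
  have n2 : ∀ x : ℝ, ¬ Cyc x (-Q) P := by
    rintro x (⟨-, h, h'⟩ | ⟨-, h, h'⟩) <;> nlinarith
  have e2 : (a - cj * b - ci * c + 2 * ci * cj) = a := by
    rcases hc with ⟨h, h'⟩ | ⟨h, h'⟩ <;> rw [h, h'] <;> ring
  have e3 : a * (2 * ci - b) * (2 * cj - c) = a * b * c := by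
    rcases hc with ⟨h, h'⟩ | ⟨h, h'⟩ <;> rw [h, h'] <;> ring
  rw [e1, e2, e3]
  refine ⟨by simpa using ha, fun h => ?_⟩
  have := (hpar h).2 (n1 _)
  exact ⟨fun _ => n2 _, fun _ => this⟩

theorem core_diff {a b c A P Q ci cj : ℝ} (ha : |a| = |A|) (hb : |b| = |P|) (hc : |c| = |Q|)
    (hpar : a * b * c ≠ 0 → (a * b * c < 0 ↔ ¬ Cyc A Q (-P)))
    (hPQ : P * Q < 0) (hcc : (ci = b ∧ cj = 0) ∨ (ci = 0 ∧ cj = c)) :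
    |a - cj * b - ci * c + 2 * ci * cj| = |A + (P * |Q| - |P| * Q) / 2| ∧
    ((a - cj * b - ci * c + 2 * ci * cj) * (2 * ci - b) * (2 * cj - c) ≠ 0 →
     ((a - cj * b - ci * c + 2 * ci * cj) * (2 * ci - b) * (2 * cj - c) < 0 ↔
       ¬ Cyc (A + (P * |Q| - |P| * Q) / 2) (-Q) P)) := by
  have e2 : (a - cj * b - ci * c + 2 * ci * cj) = a - b * c := by
    rcases hcc with ⟨h, h'⟩ | ⟨h, h'⟩ <;> rw [h, h'] <;> ring
  have e3 : ∀ x : ℝ, x * (2 * ci - b) * (2 * cj - c) = -(x * (b * c)) := by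
    intro x
    rcases hcc with ⟨h, h'⟩ | ⟨h, h'⟩ <;> rw [h, h'] <;> ring
  rw [e2, e3]
  have hP : P ≠ 0 := by rintro rfl; simp at hPQ
  have hQ : Q ≠ 0 := by rintro rfl; simp at hPQ
  have hbc : b * c = P * Q ∨ b * c = -(P * Q) := by
    apply abs_eq_abs.1; rw [abs_mul, abs_mul, hb, hc]
  have hbc0 : b * c ≠ 0 := by
    rcases hbc with h | h <;> rw [h] <;> simp [hP, hQ]
  -- a Gram product and the arrow product have opposite or equal sign according to the orientation
  obtain ⟨s, hs, e1, c1, c2⟩ : ∃ s : ℝ, (s = 1 ∨ s = -1) ∧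
      (P * |Q| - |P| * Q) / 2 = s * (P * Q) ∧ (∀ x : ℝ, Cyc x Q (-P) ↔ 0 < s * x) ∧
      (∀ x : ℝ, Cyc x (-Q) P ↔ s * x < 0) := by
    rcases lt_or_gt_of_ne hP with h | h
    · have h' : 0 < Q := by nlinarith
      refine ⟨1, Or.inl rfl, ?_, fun x => ?_, fun x => ?_⟩
      · rw [abs_of_neg h, abs_of_pos h']; ring
      · unfold Cyc
        constructor
        · rintro (⟨h1, -, -⟩ | ⟨h1, h2, -⟩) <;> linarith
        · intro h1; left; refine ⟨by linarith, h', by linarith⟩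
      · unfold Cyc
        constructor
        · rintro (⟨h1, h2, -⟩ | ⟨h1, h2, -⟩) <;> linarith
        · intro h1; right; refine ⟨by linarith, by linarith, by linarith⟩
    · have h' : Q < 0 := by nlinarith
      refine ⟨-1, Or.inr rfl, ?_, fun x => ?_, fun x => ?_⟩
      · rw [abs_of_pos h, abs_of_neg h']; ring
      · unfold Cyc
        constructor
        · rintro (⟨h1, h2, -⟩ | ⟨h1, h2, -⟩) <;> linarith
        · intro h1; right; refine ⟨by linarith, h', by linarith⟩
      · unfold Cyc
        constructor
        · rintro (⟨h1, h2, -⟩ | ⟨h1, h2, -⟩) <;> linarith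
        · intro h1; left; refine ⟨by linarith, by linarith, by linarith⟩
  rw [e1]
  rw [c1] at hpar
  rw [c2]
  have hs2 : s * s = 1 := by rcases hs with h | h <;> rw [h] <;> norm_num
  have key : a * (b * c) = -(s * A) * (P * Q) := by
    have h1 : |a * (b * c)| = |-(s * A) * (P * Q)| := by
      rw [abs_mul, abs_mul, abs_mul, abs_neg, abs_mul, abs_mul, ha, hb, hc]
      rcases hs with h | h <;> rw [h] <;> simp
    by_cases h0 : a = 0
    · have : A = 0 := by simpa [h0] using ha.symm
      simp [h0, this]
    have h2 := hpar (by rw [mul_assoc]; exact mul_ne_zero h0 hbc0)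
    rw [mul_assoc] at h2
    by_cases h3 : 0 < s * A
    · have h4 : ¬ a * (b * c) < 0 := fun h => (h2.1 h) h3
      have h5 : 0 < -(s * A) * (P * Q) := by nlinarith
      rw [abs_of_nonneg (not_lt.1 h4), abs_of_pos h5] at h1
      exact h1
    · have h4 := h2.2 h3
      have h5 : -(s * A) * (P * Q) ≤ 0 := by nlinarith
      rw [abs_of_neg h4, abs_of_nonpos h5] at h1
      linarith
  have hPQ0 : P * Q ≠ 0 := hPQ.ne
  have rel : ∃ t : ℝ, (t = 1 ∨ t = -1) ∧ b * c = t * (P * Q) ∧ a = -(t * (s * A)) := by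
    rcases hbc with h | h
    · refine ⟨1, Or.inl rfl, by linarith, ?_⟩
      rw [h] at key
      have := mul_right_cancel₀ hPQ0 key
      linarith
    · refine ⟨-1, Or.inr rfl, by linarith, ?_⟩
      rw [h] at key
      have : a = s * A := mul_right_cancel₀ hPQ0 (by linarith)
      linarith
  obtain ⟨t, ht, hbct, hat⟩ := rel
  have hd : a - b * c = -(t * s) * (A + s * (P * Q)) := by
    rw [hbct, hat]
    linear_combination (t * P * Q) * hs2
  have ht2 : t * t = 1 := by rcases ht with h | h <;> rw [h] <;> norm_num
  have hpr : -((a - b * c) * (b * c)) = (s * (A + s * (P * Q))) * (P * Q) := by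
    rw [hd, hbct]
    linear_combination (s * (A + s * (P * Q)) * (P * Q)) * ht2
  constructor
  · rw [hd, abs_mul]
    rcases ht with h | h <;> rcases hs with h' | h' <;> rw [h, h'] <;> simp
  · rw [hpr]
    intro h0
    have h1 : s * (A + s * (P * Q)) ≠ 0 := left_ne_zero_of_mul h0
    constructor
    · intro h2 h3; nlinarith
    · intro h2
      have : 0 < s * (A + s * (P * Q)) := lt_of_le_of_ne (not_lt.1 h2) h1.symm
      nlinarith
theorem core {a b c A P Q ci cj : ℝ} {pos : Prop} (ha : |a| = |A|) (hb : |b| = |P|) (hc : |c| = |Q|)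
    (hpar : a * b * c ≠ 0 → (a * b * c < 0 ↔ ¬ Cyc A Q (-P)))
    (hci : ((pos ∧ P < 0) ∨ (¬pos ∧ 0 < P)) ∧ ci = b ∨
      ¬((pos ∧ P < 0) ∨ (¬pos ∧ 0 < P)) ∧ ci = 0)
    (hcj : ((pos ∧ Q < 0) ∨ (¬pos ∧ 0 < Q)) ∧ cj = c ∨
      ¬((pos ∧ Q < 0) ∨ (¬pos ∧ 0 < Q)) ∧ cj = 0) :
    |a - cj * b - ci * c + 2 * ci * cj| = |A + (P * |Q| - |P| * Q) / 2| ∧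
    |2 * ci - b| = |P| ∧ |2 * cj - c| = |Q| ∧
    ((a - cj * b - ci * c + 2 * ci * cj) * (2 * ci - b) * (2 * cj - c) ≠ 0 →
     ((a - cj * b - ci * c + 2 * ci * cj) * (2 * ci - b) * (2 * cj - c) < 0 ↔
       ¬ Cyc (A + (P * |Q| - |P| * Q) / 2) (-Q) P)) := by
  have hci' : ci = b ∨ ci = 0 := by tauto
  have hcj' : cj = c ∨ cj = 0 := by tauto
  have h2 : |2 * ci - b| = |P| := by
    rcases hci' with h | h <;> rw [h, ← hb]
    · congr 1; ring
    · rw [← abs_neg b]; congr 1; ring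
  have h3 : |2 * cj - c| = |Q| := by
    rcases hcj' with h | h <;> rw [h, ← hc]
    · congr 1; ring
    · rw [← abs_neg c]; congr 1; ring
  by_cases hP : P = 0
  · have hb0 : b = 0 := by simpa [hP] using hb
    have hci0 : ci = 0 := by rcases hci' with h | h <;> simp [h, hb0]
    refine ⟨?_, h2, h3, ?_⟩
    · simp [hP, hb0, hci0, ha]
    · intro h; simp [hb0, hci0] at h
  by_cases hQ : Q = 0
  · have hb0 : c = 0 := by simpa [hQ] using hc
    have hci0 : cj = 0 := by rcases hcj' with h | h <;> simp [h, hb0]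
    refine ⟨?_, h2, h3, ?_⟩
    · simp [hQ, hb0, hci0, ha]
    · intro h; simp [hb0, hci0] at h
  have main : 0 < P * Q ∧ ((ci = b ∧ cj = c) ∨ (ci = 0 ∧ cj = 0)) ∨
      P * Q < 0 ∧ ((ci = b ∧ cj = 0) ∨ (ci = 0 ∧ cj = c)) := by
    by_cases hpos : pos <;>
    rcases lt_or_gt_of_ne hP with hP | hP <;> rcases lt_or_gt_of_ne hQ with hQ | hQ <;>
    simp only [hpos, hP, hQ, hP.le.not_gt, hQ.le.not_gt, true_and, false_and, and_false, not_true,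
      not_false_iff, or_false, false_or, or_true] at hci hcj
    · exact Or.inl ⟨by nlinarith, by tauto⟩
    · exact Or.inr ⟨by nlinarith, by tauto⟩
    · exact Or.inr ⟨by nlinarith, by tauto⟩
    · exact Or.inl ⟨by nlinarith, by tauto⟩
    · exact Or.inl ⟨by nlinarith, by tauto⟩
    · exact Or.inr ⟨by nlinarith, by tauto⟩
    · exact Or.inr ⟨by nlinarith, by tauto⟩
    · exact Or.inl ⟨by nlinarith, by tauto⟩
  rcases main with ⟨h, h'⟩ | ⟨h, h'⟩
  · obtain ⟨h4, h5⟩ := core_same ha hpar h h'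
    exact ⟨h4, h2, h3, h5⟩
  · obtain ⟨h4, h5⟩ := core_diff ha hb hc hpar h h'
    exact ⟨h4, h2, h3, h5⟩

open Classical in
theorem even_card_iff {g : Fin 3 → Fin 3 → ℝ} (h01 : g 0 1 ≠ 0) (h02 : g 0 2 ≠ 0)
    (h12 : g 1 2 ≠ 0) :
    Even (Finset.univ.filter
      (fun p : Fin 3 × Fin 3 => p.1 < p.2 ∧ 0 < g p.1 p.2)).card ↔ g 0 1 * g 0 2 * g 1 2 < 0 := by
  have hc : (Finset.univ.filter (fun p : Fin 3 × Fin 3 => p.1 < p.2 ∧ 0 < g p.1 p.2)).card =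
      (if 0 < g 0 1 then 1 else 0) + (if 0 < g 0 2 then 1 else 0) +
        (if 0 < g 1 2 then 1 else 0) := by
    rw [Finset.card_filter, Fintype.sum_prod_type]
    simp only [Fin.sum_univ_three]
    simp
  rw [hc]
  rcases lt_or_gt_of_ne h01 with a | a <;> rcases lt_or_gt_of_ne h02 with b | b <;>
    rcases lt_or_gt_of_ne h12 with c | c <;>
    simp [a, b, c, a.le.not_gt, b.le.not_gt, c.le.not_gt, mul_neg_iff, mul_pos_iff, Nat.even_iff]

theorem form_comm (f g : AffFun) : form f g = form g f := real_inner_comm _ _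

theorem form_sub_smul (f g e : AffFun) (c d : ℝ) :
    form (f - c • e) (g - d • e) =
      form f g - d * form f e - c * form g e + c * d * form e e := by
  simp only [form, Prod.fst_sub, Prod.smul_fst, inner_sub_left, inner_sub_right, inner_smul_left,
    inner_smul_right, real_inner_comm g.1 e.1, RCLike.conj_to_real]
  ring

/-- Mutation of the vectors, written uniformly. -/
theorem mutateVectors_eq (Pos : AffFun → Prop) {v : Fin 3 → AffFun}
    {B : Matrix (Fin 3) (Fin 3) ℝ} (k : Fin 3) :
    ∃ c : Fin 3 → ℝ, c k = 2 ∧ (∀ i, mutateVectors Pos v B k i = v i - c i • v k) ∧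
      ∀ i, i ≠ k →
        (((Pos (v k) ∧ B i k < 0) ∨ (¬ Pos (v k) ∧ 0 < B i k)) ∧ c i = form (v i) (v k) ∨
        ¬ ((Pos (v k) ∧ B i k < 0) ∨ (¬ Pos (v k) ∧ 0 < B i k)) ∧ c i = 0) := by
  classical
  refine ⟨fun i => if i = k then 2 else
    if (Pos (v k) ∧ B i k < 0) ∨ (¬ Pos (v k) ∧ 0 < B i k) then form (v i) (v k) else 0,
    by simp, fun i => ?_, fun i hi => ?_⟩
  · by_cases hi : i = k
    · subst hi
      simp only [mutateVectors, if_true, two_smul]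
      abel
    · simp only [mutateVectors, hi, if_false]
      split_ifs <;> simp
  · simp only [hi, if_false]
    split_ifs with h
    · exact Or.inl ⟨h, rfl⟩
    · exact Or.inr ⟨h, rfl⟩

open Classical in
theorem parity_iff {v : Fin 3 → AffFun} {B : Matrix (Fin 3) (Fin 3) ℝ} (hB : B.transpose = -B) :
    ((∀ i j, i < j → form (v i) (v j) ≠ 0) →
      (Even (Finset.univ.filter (fun p : Fin 3 × Fin 3 =>
        p.1 < p.2 ∧ 0 < form (v p.1) (v p.2))).card ↔ IsAcyclic B)) ↔
    (form (v 0) (v 1) * form (v 0) (v 2) * form (v 1) (v 2) ≠ 0 →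
      (form (v 0) (v 1) * form (v 0) (v 2) * form (v 1) (v 2) < 0 ↔
        ¬ Cyc (B 0 1) (B 1 2) (B 2 0))) := by
  have hn : (∀ i j, i < j → form (v i) (v j) ≠ 0) ↔
      form (v 0) (v 1) * form (v 0) (v 2) * form (v 1) (v 2) ≠ 0 := by
    constructor
    · intro h
      exact mul_ne_zero (mul_ne_zero (h 0 1 (by decide)) (h 0 2 (by decide))) (h 1 2 (by decide))
    · intro h i j hij
      have h1 := right_ne_zero_of_mul h
      have h2 := left_ne_zero_of_mul h
      have h3 := right_ne_zero_of_mul h2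
      have h4 := left_ne_zero_of_mul h2
      fin_cases i <;> fin_cases j <;> first
        | exact absurd hij (by decide)
        | assumption
  rw [isAcyclic_iff hB, hn]
  refine forall_congr' fun h => ?_
  rw [even_card_iff (g := fun i j => form (v i) (v j)) (left_ne_zero_of_mul (left_ne_zero_of_mul h))
    (right_ne_zero_of_mul (left_ne_zero_of_mul h)) (right_ne_zero_of_mul h)]

theorem mutate_core (Pos : AffFun → Prop) {v : Fin 3 → AffFun} {B : Matrix (Fin 3) (Fin 3) ℝ}
    (hB : B.transpose = -B) (hv : IsGeometricRealisation v B) {i j k : Fin 3}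
    (hij : i ≠ j) (hik : i ≠ k) (hjk : j ≠ k)
    (hpar : form (v i) (v j) * form (v i) (v k) * form (v j) (v k) ≠ 0 →
      (form (v i) (v j) * form (v i) (v k) * form (v j) (v k) < 0 ↔
        ¬ Cyc (B i j) (B j k) (B k i)))
    {v' : Fin 3 → AffFun} (hv' : v' = mutateVectors Pos v B k)
    {B' : Matrix (Fin 3) (Fin 3) ℝ} (hB' : B' = mutateMatrix B k) :
    |form (v' i) (v' j)| = |B' i j| ∧ |form (v' i) (v' k)| = |B' i k| ∧
    |form (v' j) (v' k)| = |B' j k| ∧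
    (form (v' i) (v' j) * form (v' i) (v' k) * form (v' j) (v' k) ≠ 0 →
      (form (v' i) (v' j) * form (v' i) (v' k) * form (v' j) (v' k) < 0 ↔
        ¬ Cyc (B' i j) (B' j k) (B' k i))) := by
  have h : ∀ i j, B j i = -B i j := fun i j => congrFun (congrFun hB i) j
  obtain ⟨c, hck, hc, hcc⟩ := mutateVectors_eq Pos (v := v) (B := B) k
  rw [h i k] at hpar
  have key := core (hv.abs_form i j hij) (hv.abs_form i k hik) (hv.abs_form j k hjk) hpar
    (hcc i hik) (hcc j hjk)
  have e1 : form (v' i) (v' j) = form (v i) (v j) - c j * form (v i) (v k) -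
      c i * form (v j) (v k) + 2 * c i * c j := by
    rw [hv', hc, hc, form_sub_smul, hv.form_self]; ring
  have e2 : form (v' i) (v' k) = 2 * c i - form (v i) (v k) := by
    rw [hv', hc, hc, form_sub_smul, hv.form_self, hck]; ring
  have e3 : form (v' j) (v' k) = 2 * c j - form (v j) (v k) := by
    rw [hv', hc, hc, form_sub_smul, hv.form_self, hck]; ring
  have m1 : B' i j = B i j + (B i k * |B j k| - |B i k| * B j k) / 2 := by
    simp only [hB', mutateMatrix, Matrix.of_apply, hik, hjk, or_self, if_false]
    rw [h j k, abs_neg]; ring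
  have m2 : B' i k = -B i k := by simp [hB', mutateMatrix]
  have m3 : B' j k = -B j k := by simp [hB', mutateMatrix]
  have m4 : B' k i = B i k := by simp [hB', mutateMatrix, h i k]
  rw [e1, e2, e3, m1, m2, m3, m4, abs_neg, abs_neg]
  exact key

theorem mutate_realisation (Pos : AffFun → Prop) {v : Fin 3 → AffFun}
    {B : Matrix (Fin 3) (Fin 3) ℝ} (hB : B.transpose = -B) (hv : IsGeometricRealisation v B)
    (k : Fin 3) : IsGeometricRealisation (mutateVectors Pos v B k) (mutateMatrix B k) := by
  have hsk := mutateMatrix_skew hB k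
  have hp := (parity_iff hB).1 hv.parity
  have hs : ∀ i j, |mutateMatrix B k j i| = |mutateMatrix B k i j| := fun i j => by
    rw [show mutateMatrix B k j i = -mutateMatrix B k i j from congrFun (congrFun hsk i) j, abs_neg]
  obtain ⟨c, hck, hc, hcc⟩ := mutateVectors_eq Pos (v := v) (B := B) k
  have main : (|form (mutateVectors Pos v B k 0) (mutateVectors Pos v B k 1)| =
        |mutateMatrix B k 0 1| ∧
      |form (mutateVectors Pos v B k 0) (mutateVectors Pos v B k 2)| = |mutateMatrix B k 0 2| ∧
      |form (mutateVectors Pos v B k 1) (mutateVectors Pos v B k 2)| = |mutateMatrix B k 1 2|) ∧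
      (form (mutateVectors Pos v B k 0) (mutateVectors Pos v B k 1) *
          form (mutateVectors Pos v B k 0) (mutateVectors Pos v B k 2) *
          form (mutateVectors Pos v B k 1) (mutateVectors Pos v B k 2) ≠ 0 →
        (form (mutateVectors Pos v B k 0) (mutateVectors Pos v B k 1) *
          form (mutateVectors Pos v B k 0) (mutateVectors Pos v B k 2) *
          form (mutateVectors Pos v B k 1) (mutateVectors Pos v B k 2) < 0 ↔
        ¬ Cyc (mutateMatrix B k 0 1) (mutateMatrix B k 1 2) (mutateMatrix B k 2 0))) := by
    have hk : k = 0 ∨ k = 1 ∨ k = 2 := by fin_cases k <;> simp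
    have rot : ∀ x y z : ℝ, Cyc x y z ↔ Cyc y z x := fun x y z => by unfold Cyc; tauto
    rcases hk with rfl | rfl | rfl
    · obtain ⟨h1, h2, h3, h4⟩ := mutate_core Pos hB hv (i := 1) (j := 2) (k := 0)
        (by decide) (by decide) (by decide)
        (by rw [form_comm (v 1) (v 0), form_comm (v 2) (v 0), ← rot]
            rw [show form (v 1) (v 2) * form (v 0) (v 1) * form (v 0) (v 2) =
              form (v 0) (v 1) * form (v 0) (v 2) * form (v 1) (v 2) by ring]
            exact hp) rfl rfl
      generalize mutateVectors Pos v B 0 = V at *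
      generalize mutateMatrix B 0 = M at *
      rw [form_comm, hs] at h2 h3
      rw [form_comm (V 1) (V 0), form_comm (V 2) (V 0), ← rot,
        show form (V 1) (V 2) * form (V 0) (V 1) * form (V 0) (V 2) =
          form (V 0) (V 1) * form (V 0) (V 2) * form (V 1) (V 2) by ring] at h4
      exact ⟨⟨h2, h3, h1⟩, h4⟩
    · obtain ⟨h1, h2, h3, h4⟩ := mutate_core Pos hB hv (i := 2) (j := 0) (k := 1)
        (by decide) (by decide) (by decide)
        (by rw [form_comm (v 2) (v 0), form_comm (v 2) (v 1), rot]
            rw [show form (v 0) (v 2) * form (v 1) (v 2) * form (v 0) (v 1) =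
              form (v 0) (v 1) * form (v 0) (v 2) * form (v 1) (v 2) by ring]
            exact hp) rfl rfl
      generalize mutateVectors Pos v B 1 = V at *
      generalize mutateMatrix B 1 = M at *
      rw [form_comm, hs] at h1 h2
      rw [form_comm (V 2) (V 0), form_comm (V 2) (V 1), rot,
        show form (V 0) (V 2) * form (V 1) (V 2) * form (V 0) (V 1) =
          form (V 0) (V 1) * form (V 0) (V 2) * form (V 1) (V 2) by ring] at h4
      exact ⟨⟨h3, h1, h2⟩, h4⟩
    · obtain ⟨h1, h2, h3, h4⟩ := mutate_core Pos hB hv (i := 0) (j := 1) (k := 2)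
        (by decide) (by decide) (by decide) hp rfl rfl
      exact ⟨⟨h1, h2, h3⟩, h4⟩
  obtain ⟨⟨h01, h02, h12⟩, h4⟩ := main
  refine ⟨?_, ?_, ?_, (parity_iff hsk).2 h4⟩
  · have hli := hv.linearIndependent
    rw [Fintype.linearIndependent_iff] at hli ⊢
    intro g hg
    have hsum : ∑ i, (g i - if i = k then ∑ j, g j * c j else 0) • v i = 0 := by
      rw [← hg]
      simp only [hc, sub_smul, smul_sub, Finset.sum_sub_distrib, ite_smul, zero_smul,
        Finset.sum_ite_eq', Finset.mem_univ, if_true, Finset.sum_smul, smul_smul]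
    have h0 := hli _ hsum
    have hne : ∀ i, i ≠ k → g i = 0 := fun i hi => by simpa [hi] using h0 i
    have hk := h0 k
    rw [Finset.sum_eq_single k (fun i _ hi => by rw [hne i hi, zero_mul]) (by simp), hck] at hk
    simp only [if_true] at hk
    intro i
    by_cases hi : i = k
    · subst hi; linarith
    · exact hne i hi
  · intro i
    rw [hc, form_sub_smul, hv.form_self, hv.form_self]
    by_cases hi : i = k
    · subst hi; rw [hck, hv.form_self]; ring
    · rcases hcc i hi with ⟨-, h⟩ | ⟨-, h⟩ <;> rw [h] <;> ring
  · intro i j hij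
    fin_cases i <;> fin_cases j <;> first
      | exact absurd rfl hij
      | assumption
      | (rw [form_comm, hs]; assumption)

/-- Mutation of seeds at `k`, with respect to a set `Pos` of positive vectors. -/
def Seed.mutate (Pos : AffFun → Prop) (S : Seed) (k : Fin 3) : Seed where
  v := mutateVectors Pos S.v S.B k
  B := mutateMatrix S.B k
  skew := mutateMatrix_skew S.skew k
  realisation := mutate_realisation Pos S.skew S.realisation k

/-- `T` is a vertex of the exchange graph of `S`: it is obtained from `S` by a finite sequence of
mutations. -/
def InExchangeGraph (Pos : AffFun → Prop) (S T : Seed) : Prop :=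
  Relation.ReflTransGen (fun S₁ S₂ : Seed => ∃ k, S₂ = S₁.mutate Pos k) S T

/-- `T = w + S`. Seeds which differ by a reordering of their three indices are identified. -/
def IsTranslate (w : Plane) (S T : Seed) : Prop :=
  ∃ σ : Equiv.Perm (Fin 3), (∀ i, T.v (σ i) = (S.v i).translate w) ∧
    ∀ i j, T.B (σ i) (σ j) = S.B i j

/-- Positivity with respect to the reference point `u` which lies infinitely far away on the line
through `p` and `q`, in the direction from `p` to `q`: the vector `f` is positive if `u` belongs to
the half-plane `{f < 0}`, i.e. if the points far out on the ray from `p` through `q` do. -/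
def IsPositive (p q : Plane) (f : AffFun) : Prop :=
  ∀ᶠ s : ℝ in atTop, f.eval (AffineMap.lineMap p q s) < 0

/-- The fundamental angle `α = π / (2n+1)`. -/
def alpha (n : ℕ) : ℝ := Real.pi / (2 * n + 1)

/-- The initial triangle has angles `α`, `nα`, `nα` at its vertices `0`, `1`, `2`. -/
structure IsInitialTriangle (n : ℕ) (t : Affine.Triangle ℝ Plane) : Prop where
  angle_zero : EuclideanGeometry.angle (t.points 1) (t.points 0) (t.points 2) = alpha n
  angle_one : EuclideanGeometry.angle (t.points 0) (t.points 1) (t.points 2) = n * alpha n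
  angle_two : EuclideanGeometry.angle (t.points 0) (t.points 2) (t.points 1) = n * alpha n

/-- The seed `S` is given by the initial triangle `t` with an acyclic quiver. The vector `S.v i`
belongs to the side opposite to vertex `i`: it vanishes on this side, and the triangle lies in the
half-plane where it is negative. In the quiver, the base (side `0`) is the source, one leg (side
`2`) is the sink, and there is an arrow from the other leg to the sink. The absolute values
of the weights are determined by the angles because `S` is a seed. -/
structure IsInitialSeed (t : Affine.Triangle ℝ Plane) (S : Seed) : Prop where
  eval_eq_zero : ∀ i j, j ≠ i → (S.v i).eval (t.points j) = 0
  eval_neg : ∀ i, (S.v i).eval (t.points i) < 0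
  arrow_zero_one : 0 < S.B 0 1
  arrow_zero_two : 0 < S.B 0 2
  arrow_one_two : 0 < S.B 1 2

/-- Positivity attached to the initial triangle. The belt line `b` joins the feet of the altitudes
on the source (side `0`) and on the sink (side `2`); the reference point lies infinitely far away
on `b` in the direction from the source to the sink. -/
def BeltPositive (t : Affine.Triangle ℝ Plane) : AffFun → Prop :=
  IsPositive (t.altitudeFoot 0) (t.altitudeFoot 2)

/-- The length `d₁` of the two legs, the longer sides of the initial triangle. -/
def legLength (t : Affine.Triangle ℝ Plane) : ℝ := dist (t.points 0) (t.points 1)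

/-- The lattice `R`, spanned by `d₁ sin(α) sin(nα) / sin²(kα)` for `k ∈ [1, n]` coprime to
`2n+1`. -/
def latticeR (n : ℕ) (d₁ : ℝ) : Submodule ℤ ℝ :=
  Submodule.span ℤ {x | ∃ k : ℕ, 1 ≤ k ∧ k ≤ n ∧ Nat.gcd k (2 * n + 1) = 1 ∧
    x = d₁ * (Real.sin (alpha n) * Real.sin (n * alpha n) / Real.sin (k * alpha n) ^ 2)}

/-- The translation lattice `L`, spanned by the lengths of all vectors which translate one vertex
of the exchange graph of `S₀` to another one. -/
def latticeL (Pos : AffFun → Prop) (S₀ : Seed) : Submodule ℤ ℝ :=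
  Submodule.span ℤ {x | ∃ (w : Plane) (S₁ S₂ : Seed), InExchangeGraph Pos S₀ S₁ ∧
    InExchangeGraph Pos S₀ S₂ ∧ IsTranslate w S₂ S₁ ∧ x = ‖w‖}

/-- The lattice `c • ℤ[2 cos α]`. -/
def cosLattice (n : ℕ) (c : ℝ) : Submodule ℤ ℝ :=
  (Subalgebra.toSubmodule (Algebra.adjoin ℤ {2 * Real.cos (alpha n)})).map (LinearMap.mulLeft ℤ c)

end RealQuiver

end

/-!
The weights of all seeds of the exchange graph are, up to sign, values of `2 cos (j α)` at integers
`j`, and a seed is described by a class `(a, b)`: its weights belong to `a`, `b` and `a + b`.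
Mutation at the middle vector replaces `(a, b)` by `(a, -b)` or leaves it alone. Mutations therefore
carry out the Euclidean algorithm on `(a, b)` modulo `2n + 1`, and lead from `(n, n)` to `(k, 0)`
for every `k` coprime to `2n + 1`. A seed of class `(k, 0)` has two parallel lines, and mutation at
one of them translates it across the strip between them. The determinant of the three vectors is
invariant up to sign, and determines the width of the strip. This gives `R ≤ L`.

Conversely, the kernel of `B` provides for each seed an affine function which is, up to sign, a
combination of `v₁, v₂, v₃` and vanishes on the line `b`, so that translations between seeds move
along `b`. As they preserve the `ℤ[2 cos α]`-span of the vectors, and the weight `2 cos (nα)` is a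
unit of `ℤ[2 cos α]`, their lengths lie in `ℤ[2 cos α] d₁`. This gives `L ≤ Z`, with `d = 1`.

The rank of `ℤ[2 cos α]` is at most `φ(2n + 1) / 2`, as `ℤ[e^{iα}]` contains two copies of it. The
`φ(2n + 1) / 2` generators of `R` are independent: the Galois conjugates of a relation
`∑ gₖ / sin² (kα) = 0` permute its coefficients, and in the conjugate where the coefficient of
largest modulus belongs to `k = 1`, its term exceeds all others together.
-/

noncomputable section

namespace RealQuiver

section Trigonometry

/-- The ring `ℤ[2 cos α]`. -/
abbrev cosRing (n : ℕ) : Subalgebra ℤ ℝ := Algebra.adjoin ℤ {2 * Real.cos (alpha n)}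

theorem alpha_pos (n : ℕ) : 0 < alpha n := by
  unfold alpha; positivity

theorem mul_alpha (n : ℕ) : (2 * n + 1 : ℝ) * alpha n = Real.pi := by
  unfold alpha; field_simp

theorem sin_pos_of_lt {n k : ℕ} (hk : 1 ≤ k) (hkn : k < 2 * n + 1) :
    0 < Real.sin (k * alpha n) := by
  have hk₀ : (0 : ℝ) < k := by exact_mod_cast hk
  have hk₁ : (k : ℝ) < 2 * n + 1 := by exact_mod_cast hkn
  apply Real.sin_pos_of_pos_of_lt_pi (mul_pos hk₀ (alpha_pos n))
  rw [← mul_alpha n]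
  exact mul_lt_mul_of_pos_right hk₁ (alpha_pos n)

theorem two_cos_mul_mem {A : Subalgebra ℤ ℝ} {θ : ℝ} (h : 2 * Real.cos θ ∈ A) (m : ℕ) :
    2 * Real.cos (m * θ) ∈ A := by
  induction m using Nat.twoStepInduction with
  | zero => simp
  | one => simp [h]
  | more m ih₁ ih₂ =>
    have hrec : 2 * Real.cos ((m + 2 : ℕ) * θ) =
        (2 * Real.cos θ) * (2 * Real.cos ((m + 1 : ℕ) * θ)) - 2 * Real.cos (m * θ) := by
      have h1 : ((m + 2 : ℕ) * θ : ℝ) = (m + 1 : ℕ) * θ + θ := by push_cast; ring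
      have h2 : (m * θ : ℝ) = (m + 1 : ℕ) * θ - θ := by push_cast; ring
      rw [h1, h2, Real.cos_add, Real.cos_sub]; ring
    rw [hrec]
    exact A.sub_mem (A.mul_mem h ih₂) ih₁

theorem exists_sin_mul_eq {A : Subalgebra ℤ ℝ} {θ : ℝ} (h : 2 * Real.cos θ ∈ A) (m : ℕ) :
    ∃ x ∈ A, Real.sin (m * θ) = x * Real.sin θ := by
  induction m using Nat.twoStepInduction with
  | zero => exact ⟨0, A.zero_mem, by simp⟩
  | one => exact ⟨1, A.one_mem, by simp⟩
  | more m ih₁ ih₂ =>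
    obtain ⟨x, hx, hmx⟩ := ih₁
    obtain ⟨y, hy, hmy⟩ := ih₂
    refine ⟨2 * Real.cos θ * y - x, A.sub_mem (A.mul_mem h hy) hx, ?_⟩
    have h1 : ((m + 2 : ℕ) * θ : ℝ) = (m + 1 : ℕ) * θ + θ := by push_cast; ring
    have h2 : (m * θ : ℝ) = (m + 1 : ℕ) * θ - θ := by push_cast; ring
    have hrec : Real.sin ((m + 2 : ℕ) * θ) =
        (2 * Real.cos θ) * Real.sin ((m + 1 : ℕ) * θ) - Real.sin (m * θ) := by
      rw [h1, h2, Real.sin_add, Real.sin_sub]; ring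
    rw [hrec, hmy, hmx]; ring

theorem two_cos_alpha_mem (n : ℕ) : 2 * Real.cos (alpha n) ∈ cosRing n :=
  Algebra.subset_adjoin rfl

theorem exists_sin_alpha_eq {n k : ℕ} (hk : Nat.gcd k (2 * n + 1) = 1) :
    ∃ x ∈ cosRing n, Real.sin (alpha n) = x * Real.sin (k * alpha n) := by
  rcases Nat.eq_zero_or_pos n with rfl | hn
  · exact ⟨0, Subalgebra.zero_mem _, by simp [alpha]⟩
  obtain ⟨m, -, hm⟩ := Nat.exists_mul_mod_eq_one_of_coprime hk (by omega)
  obtain ⟨x, hx, ex⟩ := exists_sin_mul_eq (two_cos_mul_mem (two_cos_alpha_mem n) k) m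
  have h1 := Nat.div_add_mod (k * m) (2 * n + 1)
  rw [hm] at h1
  set q := k * m / (2 * n + 1)
  have h2 : (m * (k * alpha n) : ℝ) = alpha n + q * Real.pi := by
    have h3 : (k * m : ℝ) = (2 * n + 1) * q + 1 := by exact_mod_cast h1.symm
    rw [← mul_alpha n]
    linear_combination alpha n * h3
  rw [h2, Real.sin_add_nat_mul_pi] at ex
  rcases neg_one_pow_eq_or ℝ q with h | h <;> rw [h] at ex
  · exact ⟨x, hx, by linarith⟩
  · exact ⟨-x, Subalgebra.neg_mem _ hx, by linarith⟩

theorem latticeR_le_cosLattice (n : ℕ) (hn : 1 ≤ n) (d : ℝ) : latticeR n d ≤ cosLattice n d := by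
  refine Submodule.span_le.2 ?_
  rintro _ ⟨k, hk1, hkn, hk, rfl⟩
  obtain ⟨x, hx, ex⟩ := exists_sin_alpha_eq hk
  obtain ⟨y, hy, ey⟩ := exists_sin_mul_eq (two_cos_alpha_mem n) n
  refine ⟨x * (y * x), Subalgebra.mul_mem _ hx (Subalgebra.mul_mem _ hy hx), ?_⟩
  have := sin_pos_of_lt hk1 (show k < 2 * n + 1 by omega)
  simp only [LinearMap.mulLeft_apply]
  rw [ey, ex]
  field_simp

end Trigonometry

section Rank

variable {n : ℕ}

theorem isPrimitiveRoot_exp_alpha_mul_I (n : ℕ) :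
    IsPrimitiveRoot (Complex.exp (alpha n * Complex.I)) (2 * (2 * n + 1)) := by
  convert Complex.isPrimitiveRoot_exp (2 * (2 * n + 1)) (by omega) using 2
  unfold alpha
  push_cast
  field_simp

theorem ofReal_mem_adjoin_exp {a : ℝ} (ha : a ∈ cosRing n) :
    (a : ℂ) ∈ Algebra.adjoin ℤ {Complex.exp (alpha n * Complex.I)} := by
  have hω := isPrimitiveRoot_exp_alpha_mul_I n
  set ω := Complex.exp (alpha n * Complex.I) with hω_def
  have hmem : ω ∈ Algebra.adjoin ℤ {ω} := Algebra.self_mem_adjoin_singleton ℤ ω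
  have hcos : ((2 * Real.cos (alpha n) : ℝ) : ℂ) = ω + ω ^ (2 * (2 * n + 1) - 1) := by
    have hinv : ω ^ (2 * (2 * n + 1) - 1) = ω⁻¹ := by
      refine eq_inv_of_mul_eq_one_left ?_
      rw [pow_sub_one_mul (by omega), hω.pow_eq_one]
    rw [hinv, hω_def, ← Complex.exp_neg, Complex.ofReal_mul, Complex.ofReal_ofNat,
      Complex.ofReal_cos, Complex.two_cos, neg_mul]
  have hle : (cosRing n).map (Complex.ofRealAm.restrictScalars ℤ) ≤ Algebra.adjoin ℤ {ω} := by
    rw [AlgHom.map_adjoin, Algebra.adjoin_le_iff, Set.image_singleton, Set.singleton_subset_iff]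
    change ((2 * Real.cos (alpha n) : ℝ) : ℂ) ∈ _
    rw [hcos]
    exact add_mem hmem (pow_mem hmem _)
  exact hle ⟨a, ha, rfl⟩

theorem finrank_adjoin_exp (n : ℕ) :
    Module.finrank ℤ (Algebra.adjoin ℤ {Complex.exp (alpha n * Complex.I)}) =
      Nat.totient (2 * n + 1) := by
  have hω := isPrimitiveRoot_exp_alpha_mul_I n
  rw [(Algebra.adjoin.powerBasis' (hω.isIntegral (by omega))).finrank,
    Algebra.adjoin.powerBasis'_dim, ← Polynomial.cyclotomic_eq_minpoly hω (by omega),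
    Polynomial.natDegree_cyclotomic, Nat.totient_two_mul_of_odd (odd_two_mul_add_one n)]

instance finite_adjoin_exp (n : ℕ) :
    Module.Finite ℤ (Algebra.adjoin ℤ {Complex.exp (alpha n * Complex.I)}) :=
  (Algebra.adjoin.powerBasis'
    ((isPrimitiveRoot_exp_alpha_mul_I n).isIntegral (by omega))).finite

instance finite_cosRing (n : ℕ) : Module.Finite ℤ (cosRing n) := by
  let f : cosRing n →ₗ[ℤ] Algebra.adjoin ℤ {Complex.exp (alpha n * Complex.I)} :=
    { toFun := fun a => ⟨(a : ℝ), ofReal_mem_adjoin_exp a.2⟩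
      map_add' := fun a b => by ext; simp
      map_smul' := fun m a => by ext; simp }
  refine Module.Finite.of_injective f fun a b h => ?_
  simpa [f] using h

/-- `(a, b) ↦ a + b exp (iα)` embeds `ℤ[2 cos α]²` into the cyclotomic ring `ℤ[exp (iα)]`. -/
theorem two_mul_finrank_cosRing_le (hn : 1 ≤ n) :
    2 * Module.finrank ℤ (cosRing n) ≤ Nat.totient (2 * n + 1) := by
  set ω := Complex.exp (alpha n * Complex.I) with hω
  let f : cosRing n × cosRing n →ₗ[ℤ] Algebra.adjoin ℤ {ω} :=
    { toFun := fun a => ⟨(a.1 : ℝ) + (a.2 : ℝ) * ω, add_mem (ofReal_mem_adjoin_exp a.1.2)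
        (mul_mem (ofReal_mem_adjoin_exp a.2.2) (Algebra.self_mem_adjoin_singleton ℤ ω))⟩
      map_add' := fun a b => by ext; simp; ring
      map_smul' := fun m a => by ext; simp; ring }
  have hf : Function.Injective f := by
    rw [← LinearMap.ker_eq_bot, LinearMap.ker_eq_bot']
    rintro ⟨⟨a, ha⟩, ⟨b, hb⟩⟩ h
    have hab : (a : ℂ) + b * ω = 0 := congrArg Subtype.val h
    have hsin : 0 < Real.sin (alpha n) := by
      simpa using sin_pos_of_lt (n := n) le_rfl (by omega)
    have hb0 : b = 0 := by
      have him := congrArg Complex.im hab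
      rw [hω, Complex.add_im, Complex.ofReal_im, Complex.im_ofReal_mul,
        Complex.exp_ofReal_mul_I_im, zero_add, Complex.zero_im] at him
      exact (mul_eq_zero.1 him).resolve_right hsin.ne'
    have ha0 : a = 0 := by simpa [hb0] using hab
    subst ha0 hb0
    rfl
  calc 2 * Module.finrank ℤ (cosRing n) = Module.finrank ℤ (cosRing n × cosRing n) := by
        rw [Module.finrank_prod, two_mul]
    _ ≤ Module.finrank ℤ (Algebra.adjoin ℤ {ω}) := LinearMap.finrank_le_finrank_of_injective hf
    _ = Nat.totient (2 * n + 1) := finrank_adjoin_exp n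

instance finite_cosLattice (n : ℕ) (c : ℝ) : Module.Finite ℤ (cosLattice n c) :=
  have : Module.Finite ℤ (Subalgebra.toSubmodule (cosRing n)) := finite_cosRing n
  inferInstanceAs (Module.Finite ℤ (Submodule.map _ _))

theorem finrank_cosLattice_le (hn : 1 ≤ n) (c : ℝ) :
    Module.finrank ℤ (cosLattice n c) ≤ Nat.totient (2 * n + 1) / 2 := by
  have : Module.Finite ℤ (Subalgebra.toSubmodule (cosRing n)) := finite_cosRing n
  refine (Submodule.finrank_map_le _ _).trans ?_
  rw [Nat.le_div_iff_mul_le two_pos, mul_comm]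
  exact two_mul_finrank_cosRing_le hn

theorem exists_algHom_gen_eq_pow {ζ : ℂ} {N j : ℕ} (hN : 0 < N) (hζ : IsPrimitiveRoot ζ N)
    (hj : Nat.Coprime j N) : ∃ f : IntermediateField.adjoin ℚ {ζ} →ₐ[ℚ] ℂ,
      f (IntermediateField.AdjoinSimple.gen ℚ ζ) = ζ ^ j := by
  have hint : IsIntegral ℚ ζ := (hζ.isIntegral hN).tower_top
  have hroot : ζ ^ j ∈ (minpoly ℚ ζ).aroots ℂ := by
    rw [Polynomial.mem_aroots, ← Polynomial.cyclotomic_eq_minpoly_rat hζ hN,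
      Polynomial.cyclotomic_eq_minpoly_rat (hζ.pow_of_coprime j hj) hN]
    exact ⟨minpoly.ne_zero (hint.pow j), minpoly.aeval ℚ _⟩
  exact ⟨_, IntermediateField.algHomAdjoinIntegralEquiv_symm_apply_gen ℚ hint ⟨ζ ^ j, hroot⟩⟩

theorem four_mul_sin_sq_eq (n m : ℕ) :
    ((4 * Real.sin (m * alpha n) ^ 2 : ℝ) : ℂ) =
      2 - Complex.exp (2 * Real.pi * Complex.I / (2 * n + 1 : ℕ)) ^ m -
        (Complex.exp (2 * Real.pi * Complex.I / (2 * n + 1 : ℕ)) ^ m)⁻¹ := by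
  have hpow : Complex.exp (2 * Real.pi * Complex.I / (2 * n + 1 : ℕ)) ^ m =
      Complex.exp (((2 * (m * alpha n) : ℝ) : ℂ) * Complex.I) := by
    rw [← Complex.exp_nat_mul]
    congr 1
    unfold alpha
    push_cast
    ring
  rw [hpow, ← Complex.exp_neg, Real.sin_sq_eq_half_sub,
    show (4 * (1 / 2 - Real.cos (2 * (m * alpha n)) / 2) : ℝ) =
      2 - 2 * Real.cos (2 * (m * alpha n)) by ring]
  rw [Complex.ofReal_sub, Complex.ofReal_mul, Complex.ofReal_cos, Complex.ofReal_ofNat,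
    Complex.two_cos, neg_mul]
  ring

theorem sum_div_sin_sq_conj {ι : Type*} {F : Finset ι} {g : ι → ℤ} {k : ι → ℕ} {j : ℕ}
    (hj : Nat.Coprime j (2 * n + 1))
    (h : ∑ i ∈ F, (g i : ℝ) / Real.sin (k i * alpha n) ^ 2 = 0) :
    ∑ i ∈ F, (g i : ℝ) / Real.sin ((j * k i : ℕ) * alpha n) ^ 2 = 0 := by
  have hζ := Complex.isPrimitiveRoot_exp (2 * n + 1) (by omega)
  have hsin := four_mul_sin_sq_eq n
  set ζ := Complex.exp (2 * Real.pi * Complex.I / (2 * n + 1 : ℕ))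
  let η := IntermediateField.AdjoinSimple.gen ℚ ζ
  let x := ∑ i ∈ F, (4 * g i : IntermediateField.adjoin ℚ {ζ}) / (2 - η ^ k i - (η ^ k i)⁻¹)
  have map_x : ∀ (m : ℕ) (f : IntermediateField.adjoin ℚ {ζ} →ₐ[ℚ] ℂ), f η = ζ ^ m →
      f x = ((∑ i ∈ F, (g i : ℝ) / Real.sin ((m * k i : ℕ) * alpha n) ^ 2 : ℝ) : ℂ) := by
    intro m f hf
    rw [map_sum, Complex.ofReal_sum]
    refine Finset.sum_congr rfl fun i _ => ?_
    rw [← mul_div_mul_left _ (Real.sin _ ^ 2) (four_ne_zero' ℝ), Complex.ofReal_div, hsin]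
    simp only [map_div₀, map_mul, map_sub, map_inv₀, map_pow, map_intCast, map_ofNat f, hf,
      pow_mul, Complex.ofReal_mul, Complex.ofReal_ofNat, Complex.ofReal_intCast]
  have hx : x = 0 := by
    have hval := map_x 1 (IntermediateField.val _) (pow_one ζ).symm
    simp only [one_mul, h, Complex.ofReal_zero] at hval
    exact (map_eq_zero _).1 hval
  obtain ⟨f, hf⟩ := exists_algHom_gen_eq_pow (by omega) hζ hj
  have hfx := map_x j f hf
  rw [hx, map_zero] at hfx
  exact_mod_cast hfx.symm

theorem sum_one_div_sq_le {M : ℕ} (hM : 1 ≤ M) :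
    ∑ m ∈ Finset.Icc 2 M, (1 : ℝ) / (m : ℝ) ^ 2 ≤ 2 / 3 - 2 / (2 * M + 1) := by
  induction M, hM using Nat.le_induction with
  | base => norm_num
  | succ M hM ih =>
    rw [Finset.sum_Icc_succ_top (by omega)]
    have : (1 : ℝ) / ((M + 1 : ℕ) : ℝ) ^ 2 ≤ 2 / (2 * M + 1) - 2 / (2 * (M + 1 : ℕ) + 1) := by
      push_cast
      rw [div_sub_div _ _ (by positivity) (by positivity), div_le_div_iff₀ (by positivity)
        (by positivity)]
      nlinarith
    linarith

theorem one_div_sin_sq_lt {x : ℝ} (h0 : 0 < x) (h1 : x < Real.pi / 2) :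
    1 / Real.sin x ^ 2 < 1 + 1 / x ^ 2 := by
  have hs : 0 < Real.sin x := Real.sin_pos_of_pos_of_lt_pi h0 (by linarith [Real.pi_pos])
  have hc : 0 < Real.cos x := Real.cos_pos_of_mem_Ioo ⟨by linarith, h1⟩
  have htan : x * Real.cos x < Real.sin x := by
    rw [← lt_div_iff₀ hc, ← Real.tan_eq_sin_div_cos]
    exact Real.lt_tan h0 h1
  calc 1 / Real.sin x ^ 2 = 1 + Real.cos x ^ 2 / Real.sin x ^ 2 := by
        field_simp
        exact (Real.sin_sq_add_cos_sq x).symm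
    _ < 1 + 1 / x ^ 2 := by
        gcongr 1 + ?_
        rw [div_lt_div_iff₀ (by positivity) (by positivity), one_mul, ← mul_pow, mul_comm]
        gcongr

theorem natCast_sub_one_le_one_div_alpha_sq_mul (n : ℕ) :
    (n - 1 : ℝ) ≤ (1 / alpha n ^ 2) * (1 / 3 + 2 / (2 * n + 1)) := by
  have hpi : Real.pi ^ 2 ≤ 10 := by nlinarith [Real.pi_lt_d2, Real.pi_pos]
  calc (n - 1 : ℝ) ≤ (2 * n + 1) ^ 2 / 10 * (1 / 3 + 2 / (2 * n + 1)) := by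
        field_simp
        nlinarith [sq_nonneg ((n : ℝ) - 2)]
    _ ≤ (2 * n + 1) ^ 2 / Real.pi ^ 2 * (1 / 3 + 2 / (2 * n + 1)) := by gcongr
    _ = (1 / alpha n ^ 2) * (1 / 3 + 2 / (2 * n + 1)) := by
        unfold alpha
        field_simp

theorem sum_one_div_sin_sq_lt (hn : 1 ≤ n) :
    ∑ m ∈ Finset.Icc 2 n, 1 / Real.sin (m * alpha n) ^ 2 < 1 / Real.sin (alpha n) ^ 2 := by
  have hα := alpha_pos n
  have hsin : 0 < Real.sin (alpha n) := by
    simpa using sin_pos_of_lt (n := n) le_rfl (by omega)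
  have hterm : ∀ m ∈ Finset.Icc 2 n,
      1 / Real.sin (m * alpha n) ^ 2 ≤ 1 + (1 / alpha n ^ 2) * (1 / (m : ℝ) ^ 2) := by
    intro m hm
    obtain ⟨hm2, hmn⟩ := Finset.mem_Icc.1 hm
    have hm0 : (0 : ℝ) < m := by exact_mod_cast (by omega : 0 < m)
    have hmn' : (m : ℝ) ≤ n := by exact_mod_cast hmn
    have hlt : m * alpha n < Real.pi / 2 := by
      rw [← mul_alpha n]
      nlinarith
    refine (one_div_sin_sq_lt (mul_pos hm0 hα) hlt).le.trans (le_of_eq ?_)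
    rw [mul_pow, one_div_mul_one_div, mul_comm]
  calc ∑ m ∈ Finset.Icc 2 n, 1 / Real.sin (m * alpha n) ^ 2
      ≤ ∑ m ∈ Finset.Icc 2 n, (1 + (1 / alpha n ^ 2) * (1 / (m : ℝ) ^ 2)) :=
        Finset.sum_le_sum hterm
    _ = (n - 1 : ℝ) + (1 / alpha n ^ 2) * ∑ m ∈ Finset.Icc 2 n, (1 : ℝ) / (m : ℝ) ^ 2 := by
        rw [Finset.sum_add_distrib, ← Finset.mul_sum, Finset.sum_const, Nat.card_Icc,
          nsmul_eq_mul, mul_one, Nat.cast_sub (by omega)]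
        push_cast
        ring
    _ ≤ (1 / alpha n ^ 2) * (1 / 3 + 2 / (2 * n + 1)) +
          (1 / alpha n ^ 2) * (2 / 3 - 2 / (2 * n + 1)) := by
        gcongr
        · exact natCast_sub_one_le_one_div_alpha_sq_mul n
        · exact sum_one_div_sq_le hn
    _ = 1 / alpha n ^ 2 := by ring
    _ < 1 / Real.sin (alpha n) ^ 2 := by
        gcongr
        exact Real.sin_lt hα

theorem sin_sq_eq_of_cast_eq_or_eq_neg {a b : ℕ}
    (h : (a : ZMod (2 * n + 1)) = b ∨ (a : ZMod (2 * n + 1)) = -b) :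
    Real.sin (a * alpha n) ^ 2 = Real.sin (b * alpha n) ^ 2 := by
  rw [Real.sin_sq_eq_half_sub, Real.sin_sq_eq_half_sub]
  rcases h with h | h
  · obtain ⟨q, hq⟩ := (ZMod.intCast_eq_intCast_iff_dvd_sub b a _).1 (by exact_mod_cast h.symm)
    have hq' : (a : ℝ) = b + (2 * n + 1) * q := by
      have : (a : ℝ) - b = (2 * n + 1) * q := by exact_mod_cast hq
      linarith
    rw [show 2 * (a * alpha n) = 2 * (b * alpha n) + q * (2 * Real.pi) by
      rw [← mul_alpha n, hq']; ring, Real.cos_add_int_mul_two_pi]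
  · obtain ⟨q, hq⟩ := (ZMod.intCast_eq_intCast_iff_dvd_sub (-b) a _).1
      (by push_cast; exact h.symm)
    have hq' : (a : ℝ) = (2 * n + 1) * q - b := by
      have : (a : ℝ) - -b = (2 * n + 1) * q := by exact_mod_cast hq
      linarith
    rw [show 2 * (a * alpha n) = q * (2 * Real.pi) - 2 * (b * alpha n) by
      rw [← mul_alpha n, hq']; ring, Real.cos_int_mul_two_pi_sub]

/-- The representative of `± x` in `[0, n]`, for a residue `x` modulo `2n+1`. -/
def absRep (x : ZMod (2 * n + 1)) : ℕ := x.valMinAbs.natAbs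

theorem natCast_absRep_eq_or_eq_neg (x : ZMod (2 * n + 1)) :
    (absRep x : ZMod (2 * n + 1)) = x ∨ (absRep x : ZMod (2 * n + 1)) = -x := by
  rw [absRep, ZMod.natCast_natAbs_valMinAbs]
  split_ifs <;> simp

theorem absRep_natCast {k : ℕ} (hk : k ≤ n) : absRep (k : ZMod (2 * n + 1)) = k := by
  rw [absRep, ZMod.valMinAbs_natCast_of_le_half (by omega), Int.natAbs_natCast]

theorem absRep_inj {x y : ZMod (2 * n + 1)} : absRep x = absRep y ↔ x = y ∨ x = -y :=
  ZMod.natAbs_valMinAbs_eq_natAbs_valMinAbs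

theorem absRep_le (x : ZMod (2 * n + 1)) : absRep x ≤ n := by
  have := ZMod.natAbs_valMinAbs_le x
  unfold absRep
  omega

theorem absRep_pos (hn : 1 ≤ n) {x : ZMod (2 * n + 1)} (hx : IsUnit x) : 0 < absRep x := by
  have : Fact (1 < 2 * n + 1) := ⟨by omega⟩
  rw [absRep, Int.natAbs_pos, ne_eq, ZMod.valMinAbs_eq_zero]
  exact hx.ne_zero

/-- The natural numbers in `[1, n]` which are coprime to `2n+1`. They index the generators
of `R`. -/
def coprimeIcc (n : ℕ) : Finset ℕ := (Finset.Icc 1 n).filter fun k => Nat.gcd k (2 * n + 1) = 1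

theorem mem_coprimeIcc {k : ℕ} :
    k ∈ coprimeIcc n ↔ 1 ≤ k ∧ k ≤ n ∧ Nat.gcd k (2 * n + 1) = 1 := by
  simp [coprimeIcc, and_assoc]

theorem isUnit_of_mem_coprimeIcc {k : ℕ} (hk : k ∈ coprimeIcc n) :
    IsUnit (k : ZMod (2 * n + 1)) :=
  (ZMod.isUnit_iff_coprime _ _).2 (mem_coprimeIcc.1 hk).2.2

theorem isUnit_inv_of_mem_coprimeIcc {k : ℕ} (hk : k ∈ coprimeIcc n) :
    IsUnit (k : ZMod (2 * n + 1))⁻¹ :=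
  .of_mul_eq_one _ (ZMod.inv_mul_of_unit _ (isUnit_of_mem_coprimeIcc hk))

theorem filter_coprime_eq_union (hn : 1 ≤ n) :
    (Finset.range (2 * n + 1)).filter (Nat.Coprime (2 * n + 1)) =
      coprimeIcc n ∪ (coprimeIcc n).image fun k => 2 * n + 1 - k := by
  ext k
  simp only [Finset.mem_filter, Finset.mem_range, Finset.mem_union, Finset.mem_image,
    mem_coprimeIcc]
  constructor
  · rintro ⟨hk, hcop⟩
    have hk0 : k ≠ 0 := by
      rintro rfl
      have := (Nat.coprime_zero_right _).1 hcop
      omega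
    by_cases hkn : k ≤ n
    · exact Or.inl ⟨by omega, hkn, hcop.symm⟩
    · refine Or.inr ⟨2 * n + 1 - k, ⟨by omega, by omega, ?_⟩, by omega⟩
      exact (Nat.coprime_self_sub_left hk.le).2 hcop.symm
  · rintro (⟨-, hkn, hcop⟩ | ⟨m, ⟨hm, hmn, hcop⟩, rfl⟩)
    · exact ⟨by omega, Nat.Coprime.symm hcop⟩
    · exact ⟨by omega, ((Nat.coprime_self_sub_left (by omega)).2 hcop).symm⟩

theorem totient_eq_two_mul_card (hn : 1 ≤ n) :
    Nat.totient (2 * n + 1) = 2 * (coprimeIcc n).card := by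
  have hbound : ∀ k ∈ coprimeIcc n, 1 ≤ k ∧ k ≤ n := fun k hk =>
    ⟨(mem_coprimeIcc.1 hk).1, (mem_coprimeIcc.1 hk).2.1⟩
  rw [Nat.totient_eq_card_coprime, filter_coprime_eq_union hn, Finset.card_union_of_disjoint,
    Finset.card_image_of_injOn, two_mul]
  · intro a ha b hb hab
    have := hbound a ha
    have := hbound b hb
    simp only at hab
    omega
  · rw [Finset.disjoint_left]
    intro a ha hb
    obtain ⟨b, hb', rfl⟩ := Finset.mem_image.1 hb
    have := hbound _ ha
    have := hbound b hb'
    omega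

/-- The Galois conjugation which maps `1 / sin² (lα)` to `1 / sin² α` maps `1 / sin² (kα)` to
`1 / sin² (mα)` with `m = conjIndex n l k`. -/
def conjIndex (n l k : ℕ) : ℕ := absRep ((l : ZMod (2 * n + 1))⁻¹ * (k : ZMod (2 * n + 1)))

theorem conjIndex_self (hn : 1 ≤ n) {l : ℕ} (hl : l ∈ coprimeIcc n) : conjIndex n l l = 1 := by
  rw [conjIndex, ZMod.inv_mul_of_unit _ (isUnit_of_mem_coprimeIcc hl)]
  exact_mod_cast absRep_natCast hn

theorem conjIndex_injOn {l : ℕ} (hl : l ∈ coprimeIcc n) :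
    Set.InjOn (conjIndex n l) (coprimeIcc n) := by
  intro a ha b hb hab
  have hunit := isUnit_inv_of_mem_coprimeIcc hl
  have hcast := absRep_inj.1 hab
  rwa [← mul_neg, hunit.mul_right_inj, hunit.mul_right_inj, ← absRep_inj,
    absRep_natCast (mem_coprimeIcc.1 ha).2.1, absRep_natCast (mem_coprimeIcc.1 hb).2.1] at hcast

theorem sum_erase_one_div_sin_sq_lt (hn : 1 ≤ n) {l : ℕ} (hl : l ∈ coprimeIcc n) :
    ∑ k ∈ (coprimeIcc n).erase l, 1 / Real.sin (conjIndex n l k * alpha n) ^ 2 <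
      1 / Real.sin (alpha n) ^ 2 := by
  have hinj := (conjIndex_injOn hl).mono (Finset.coe_subset.2 (Finset.erase_subset l _))
  have hmaps : ((coprimeIcc n).erase l).image (conjIndex n l) ⊆ Finset.Icc 2 n := by
    intro m hm
    obtain ⟨k, hk, rfl⟩ := Finset.mem_image.1 hm
    obtain ⟨hkl, hk⟩ := Finset.mem_erase.1 hk
    have hne : conjIndex n l k ≠ 1 := fun h =>
      hkl (conjIndex_injOn hl hk hl (h.trans (conjIndex_self hn hl).symm))
    have hpos : 0 < conjIndex n l k :=
      absRep_pos hn ((isUnit_inv_of_mem_coprimeIcc hl).mul (isUnit_of_mem_coprimeIcc hk))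
    exact Finset.mem_Icc.2 ⟨by omega, absRep_le _⟩
  rw [← Finset.sum_image (f := fun m : ℕ => 1 / Real.sin (m * alpha n) ^ 2) hinj]
  exact (Finset.sum_le_sum_of_subset_of_nonneg hmaps fun _ _ _ => by positivity).trans_lt
    (sum_one_div_sin_sq_lt hn)

theorem sum_div_sin_sq_conjIndex {g : coprimeIcc n → ℤ}
    (h : ∑ k, (g k : ℝ) / Real.sin ((k : ℕ) * alpha n) ^ 2 = 0) (l : coprimeIcc n) :
    ∑ k : coprimeIcc n, (g k : ℝ) / Real.sin (conjIndex n l k * alpha n) ^ 2 = 0 := by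
  have hcop : Nat.Coprime ((l : ZMod (2 * n + 1))⁻¹).val (2 * n + 1) := by
    rw [← ZMod.isUnit_iff_coprime, ZMod.natCast_zmod_val]
    exact isUnit_inv_of_mem_coprimeIcc l.2
  rw [← sum_div_sin_sq_conj hcop h]
  refine Finset.sum_congr rfl fun k _ => ?_
  rw [sin_sq_eq_of_cast_eq_or_eq_neg]
  rw [Nat.cast_mul, ZMod.natCast_zmod_val]
  exact natCast_absRep_eq_or_eq_neg _

/-- The matrix of the conjugates of the numbers `1 / sin² (kα)` is diagonally dominant when the
conjugation which maps `k` to `1` is used for the row of `k`. -/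
theorem linearIndependent_div_sin_sq (hn : 1 ≤ n) {c : ℝ} (hc : c ≠ 0) :
    LinearIndependent ℤ fun k : coprimeIcc n => c / Real.sin ((k : ℕ) * alpha n) ^ 2 := by
  let M : Matrix (coprimeIcc n) (coprimeIcc n) ℝ := fun l k =>
    1 / Real.sin (conjIndex n l k * alpha n) ^ 2
  have hdet : M.det ≠ 0 := by
    refine det_ne_zero_of_sum_row_lt_diag fun l => ?_
    have hnorm : ∀ k, ‖M l k‖ = M l k := fun k =>
      Real.norm_of_nonneg (one_div_nonneg.2 (sq_nonneg _))
    have hdiag : M l l = 1 / Real.sin (alpha n) ^ 2 := by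
      simp only [M, conjIndex_self hn l.2, Nat.cast_one, one_mul]
    have himage : (coprimeIcc n).erase l = (Finset.univ.erase l).image Subtype.val := by
      rw [Finset.image_erase Subtype.val_injective, Finset.univ_eq_attach,
        Finset.attach_image_val]
    simp only [hnorm]
    rw [hdiag]
    simp only [M]
    rw [← Finset.sum_image (f := fun k => 1 / Real.sin (conjIndex n l k * alpha n) ^ 2)
      Subtype.val_injective.injOn, ← himage]
    exact sum_erase_one_div_sin_sq_lt hn l.2
  rw [Fintype.linearIndependent_iff]
  intro g hg
  have hsum : ∑ k : coprimeIcc n, (g k : ℝ) / Real.sin ((k : ℕ) * alpha n) ^ 2 = 0 := by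
    refine (mul_eq_zero.1 (?_ : c * _ = 0)).resolve_left hc
    rw [← hg, Finset.mul_sum]
    exact Finset.sum_congr rfl fun k _ => by rw [zsmul_eq_mul]; ring
  have hker : M.mulVec (fun k => (g k : ℝ)) = 0 := by
    ext l
    rw [Pi.zero_apply, ← sum_div_sin_sq_conjIndex hsum l]
    simp only [Matrix.mulVec, dotProduct, M, one_div_mul_eq_div]
  intro k
  have hk : (g k : ℝ) = 0 := congrFun (Matrix.eq_zero_of_mulVec_eq_zero hdet hker) k
  exact_mod_cast hk

theorem finrank_latticeR (hn : 1 ≤ n) {d : ℝ} (hd : d ≠ 0) :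
    Module.finrank ℤ (latticeR n d) = Nat.totient (2 * n + 1) / 2 := by
  have hsin₁ : 0 < Real.sin (alpha n) := by
    simpa using sin_pos_of_lt (n := n) le_rfl (by omega)
  have hsin := sin_pos_of_lt hn (show n < 2 * n + 1 by omega)
  have hli := linearIndependent_div_sin_sq hn
    (mul_ne_zero hd (mul_ne_zero hsin₁.ne' hsin.ne'))
  have hspan : latticeR n d = Submodule.span ℤ (Set.range fun k : coprimeIcc n =>
      d * (Real.sin (alpha n) * Real.sin (n * alpha n)) / Real.sin ((k : ℕ) * alpha n) ^ 2) := by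
    unfold latticeR
    congr 1
    ext x
    simp only [Set.mem_ofPred_eq, Set.mem_range, Subtype.exists, mem_coprimeIcc, mul_div_assoc,
      exists_prop, and_assoc, eq_comm (a := x)]
  rw [hspan, finrank_span_eq_card hli, totient_eq_two_mul_card hn]
  simp

theorem finrank_of_latticeR_le (hn : 1 ≤ n) {d : ℝ} (hd : d ≠ 0) {M : Submodule ℤ ℝ}
    (hRM : latticeR n d ≤ M) (hMZ : M ≤ cosLattice n d) :
    Module.finrank ℤ M = Nat.totient (2 * n + 1) / 2 := by
  have : Module.Finite ℤ M := Module.Finite.of_injective (Submodule.inclusion hMZ)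
    (Submodule.inclusion_injective hMZ)
  refine le_antisymm ((Submodule.finrank_mono hMZ).trans (finrank_cosLattice_le hn d)) ?_
  rw [← finrank_latticeR hn hd]
  exact Submodule.finrank_mono hRM

end Rank

section Plane

theorem plane_inner_eq (x y : Plane) : inner ℝ x y = x 0 * y 0 + x 1 * y 1 := by
  simp [PiLp.inner_apply, Fin.sum_univ_two, mul_comm]

/-- The inner product of `x` and `y` in terms of their coordinates with respect to the dual basis
of `a` and `b`. -/
theorem inner_mul_gram (a b x y : Plane) :
    inner ℝ x y * (inner ℝ a a * inner ℝ b b - inner ℝ a b ^ 2) =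
      inner ℝ a x * inner ℝ a y * inner ℝ b b + inner ℝ b x * inner ℝ b y * inner ℝ a a -
        (inner ℝ a x * inner ℝ b y + inner ℝ b x * inner ℝ a y) * inner ℝ a b := by
  simp only [plane_inner_eq]
  ring

theorem exists_eq_smul_of_inner_eq_zero {a b w : Plane} (ha : a ≠ 0) (hw : w ≠ 0)
    (haw : inner ℝ a w = 0) (hbw : inner ℝ b w = 0) : ∃ c : ℝ, b = c • a := by
  have haa : a 0 * a 0 + a 1 * a 1 ≠ 0 := by
    rw [← plane_inner_eq]
    exact inner_self_ne_zero.2 ha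
  have hww : w 0 * w 0 + w 1 * w 1 ≠ 0 := by
    rw [← plane_inner_eq]
    exact inner_self_ne_zero.2 hw
  rw [plane_inner_eq] at haw hbw
  have hdet : a 0 * b 1 - a 1 * b 0 = 0 := by
    refine (mul_eq_zero.1 ?_).resolve_right hww
    linear_combination (w 0 * b 1 - w 1 * b 0) * haw + (a 0 * w 1 - a 1 * w 0) * hbw
  refine ⟨(a 0 * b 0 + a 1 * b 1) / (a 0 * a 0 + a 1 * a 1), ?_⟩
  ext i
  rw [PiLp.smul_apply, smul_eq_mul, div_mul_eq_mul_div, eq_div_iff haa]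
  fin_cases i <;> simp only [Fin.zero_eta, Fin.mk_one]
  · linear_combination -a 1 * hdet
  · linear_combination a 0 * hdet

theorem exists_inner_eq {a b : Plane} (h : inner ℝ a a * inner ℝ b b - inner ℝ a b ^ 2 ≠ 0)
    (x y : ℝ) : ∃ w : Plane, inner ℝ a w = x ∧ inner ℝ b w = y := by
  have hdet : a 0 * b 1 - a 1 * b 0 ≠ 0 := by
    intro h0
    apply h
    simp only [plane_inner_eq]
    linear_combination (a 0 * b 1 - a 1 * b 0) * h0
  refine ⟨!₂[(x * b 1 - y * a 1) / (a 0 * b 1 - a 1 * b 0),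
    (y * a 0 - x * b 0) / (a 0 * b 1 - a 1 * b 0)], ?_, ?_⟩ <;>
  · simp only [plane_inner_eq, Matrix.cons_val_zero, Matrix.cons_val_one]
    rw [mul_div_assoc', mul_div_assoc', ← add_div, div_eq_iff hdet]
    ring

end Plane

section AffineFunctions

theorem eval_add (f g : AffFun) (x : Plane) : (f + g).eval x = f.eval x + g.eval x := by
  simp only [AffFun.eval, Prod.fst_add, Prod.snd_add, inner_add_left]
  ring

theorem eval_smul (c : ℝ) (f : AffFun) (x : Plane) : AffFun.eval (c • f) x = c * f.eval x := by
  simp only [AffFun.eval, Prod.smul_fst, Prod.smul_snd, real_inner_smul_left, smul_eq_mul]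
  ring

theorem eval_neg (f : AffFun) (x : Plane) : (-f).eval x = -f.eval x := by
  rw [← neg_one_smul ℝ, eval_smul, neg_one_mul]

theorem eval_sub_eval (f : AffFun) (x y : Plane) :
    f.eval x - f.eval y = inner ℝ f.1 (x - y) := by
  simp only [AffFun.eval, inner_sub_right]
  ring

theorem eval_lineMap (f : AffFun) (p q : Plane) (s : ℝ) :
    f.eval (AffineMap.lineMap p q s) = f.eval p + s * inner ℝ f.1 (q - p) := by
  simp only [AffFun.eval, AffineMap.lineMap_apply, vsub_eq_sub, vadd_eq_add, inner_add_right,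
    real_inner_smul_right]
  ring

theorem fst_eq_smul_of_form_eq {f g : AffFun} {t : ℝ} (ht : t ^ 2 = 1) (hf : form f f = 2)
    (hg : form g g = 2) (hfg : form f g = 2 * t) : g.1 = t • f.1 := by
  rw [← sub_eq_zero, ← inner_self_eq_zero (𝕜 := ℝ)]
  simp only [form] at hf hg hfg
  simp only [inner_sub_left, inner_sub_right, real_inner_smul_left, real_inner_smul_right,
    real_inner_comm f.1 g.1, hf, hg, hfg]
  linear_combination -2 * ht

theorem isPositive_of_inner_neg {f : AffFun} {p q : Plane} (h : inner ℝ f.1 (q - p) < 0) :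
    IsPositive p q f := by
  unfold IsPositive
  filter_upwards [eventually_gt_atTop (f.eval p / -inner ℝ f.1 (q - p))] with s hs
  rw [eval_lineMap]
  have := (div_lt_iff₀ (neg_pos.2 h)).1 hs
  linarith

theorem isPositive_of_inner_eq_zero {f : AffFun} {p q : Plane} (h : inner ℝ f.1 (q - p) = 0)
    (hp : f.eval p < 0) : IsPositive p q f :=
  Eventually.of_forall fun s => by rwa [eval_lineMap, h, mul_zero, add_zero]

theorem IsPositive.not_neg {f : AffFun} {p q : Plane} (h : IsPositive p q f) :
    ¬ IsPositive p q (-f) := by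
  intro h'
  obtain ⟨s, hs, hs'⟩ := (h.and h').exists
  rw [eval_neg] at hs'
  linarith

/-- The affine function `f` vanishes on the line through `p` and `q`. -/
def VanishesOn (p q : Plane) (f : AffFun) : Prop :=
  f.eval p = 0 ∧ inner ℝ f.1 (q - p) = 0

theorem VanishesOn.neg {f : AffFun} {p q : Plane} (h : VanishesOn p q f) :
    VanishesOn p q (-f) := by
  refine ⟨by rw [eval_neg, h.1, neg_zero], ?_⟩
  rw [Prod.fst_neg, inner_neg_left, h.2, neg_zero]

theorem VanishesOn.eval_lineMap {f : AffFun} {p q : Plane} (h : VanishesOn p q f) (s : ℝ) :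
    f.eval (AffineMap.lineMap p q s) = 0 := by
  rw [RealQuiver.eval_lineMap, h.1, h.2, mul_zero, add_zero]

theorem vanishesOn_of_not_isPositive {f : AffFun} {p q : Plane} (h : ¬ IsPositive p q f)
    (h' : ¬ IsPositive p q (-f)) : VanishesOn p q f := by
  have hneg : ∀ x, inner ℝ (-f).1 x = -inner ℝ f.1 x := fun x => inner_neg_left f.1 x
  have hinner : inner ℝ f.1 (q - p) = 0 := by
    refine le_antisymm (not_lt.1 fun hlt => h' (isPositive_of_inner_neg ?_))
      (not_lt.1 fun hlt => h (isPositive_of_inner_neg hlt))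
    rwa [hneg, neg_lt_zero]
  refine ⟨le_antisymm (not_lt.1 fun hlt => h' (isPositive_of_inner_eq_zero ?_ ?_))
    (not_lt.1 fun hlt => h (isPositive_of_inner_eq_zero hinner hlt)), hinner⟩
  · rw [hneg, hinner, neg_zero]
  · rwa [eval_neg, neg_lt_zero]

theorem VanishesOn.exists_eq_smul {f g : AffFun} {p q : Plane} (hpq : p ≠ q) (hf : f.1 ≠ 0)
    (hfpq : VanishesOn p q f) (hgpq : VanishesOn p q g) : ∃ c : ℝ, g = c • f := by
  obtain ⟨hfp, hfw⟩ := hfpq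
  obtain ⟨hgp, hgw⟩ := hgpq
  obtain ⟨c, hc⟩ := exists_eq_smul_of_inner_eq_zero hf (sub_ne_zero.2 hpq.symm) hfw hgw
  refine ⟨c, Prod.ext hc ?_⟩
  simp only [AffFun.eval] at hfp hgp
  rw [hc, real_inner_smul_left] at hgp
  simp only [Prod.smul_snd, smul_eq_mul]
  linear_combination hgp - c * hfp

end AffineFunctions

section Triples

theorem distinct_induction {P : Fin 3 → Fin 3 → Fin 3 → Prop} (h : P 0 1 2)
    (rotate : ∀ {i j k}, P i j k → P j k i) (swap : ∀ {i j k}, P i j k → P j i k)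
    {i j k : Fin 3} (hij : i ≠ j) (hik : i ≠ k) (hjk : j ≠ k) : P i j k := by
  have key : ∀ i j k : Fin 3, i ≠ j → i ≠ k → j ≠ k →
      (i, j, k) = (0, 1, 2) ∨ (i, j, k) = (1, 2, 0) ∨ (i, j, k) = (2, 0, 1) ∨
      (i, j, k) = (1, 0, 2) ∨ (i, j, k) = (2, 1, 0) ∨ (i, j, k) = (0, 2, 1) := by decide
  simp only [Prod.mk.injEq] at key
  rcases key i j k hij hik hjk with
    ⟨rfl, rfl, rfl⟩ | ⟨rfl, rfl, rfl⟩ | ⟨rfl, rfl, rfl⟩ | ⟨rfl, rfl, rfl⟩ | ⟨rfl, rfl, rfl⟩ |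
    ⟨rfl, rfl, rfl⟩
  exacts [h, rotate h, rotate (rotate h), swap h, swap (rotate h), swap (rotate (rotate h))]

theorem eq_or_eq_or_eq {i j k : Fin 3} (hij : i ≠ j) (hik : i ≠ k) (hjk : j ≠ k) (m : Fin 3) :
    m = i ∨ m = j ∨ m = k := by
  omega

theorem exists_distinct (k : Fin 3) : ∃ i j : Fin 3, i ≠ j ∧ i ≠ k ∧ j ≠ k := by
  revert k
  decide

end Triples

section Seeds

variable {S : Seed} {i j k : Fin 3}

theorem Seed.B_skew (S : Seed) (i j : Fin 3) : S.B j i = -S.B i j :=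
  congrFun (congrFun S.skew i) j

theorem fst_v_ne_zero (S : Seed) (i : Fin 3) : (S.v i).1 ≠ 0 := by
  intro h
  have := S.realisation.form_self i
  simp [form, h] at this

theorem eq_zero_of_smul_add_smul_add_smul (hij : i ≠ j) (hik : i ≠ k) (hjk : j ≠ k) {x y z : ℝ}
    (h : x • S.v i + y • S.v j + z • S.v k = 0) : x = 0 ∧ y = 0 ∧ z = 0 := by
  revert x y z
  refine distinct_induction (P := fun i j k => ∀ {x y z : ℝ},
    x • S.v i + y • S.v j + z • S.v k = 0 → x = 0 ∧ y = 0 ∧ z = 0) ?_ ?_ ?_ hij hik hjk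
  · intro x y z h
    have := Fintype.linearIndependent_iff.1 S.realisation.linearIndependent ![x, y, z]
      (by simpa [Fin.sum_univ_three] using h)
    exact ⟨this 0, this 1, this 2⟩
  · intro i j k ih x y z h
    obtain ⟨hz, hx, hy⟩ := ih (x := z) (y := x) (z := y) (by rw [← h]; abel)
    exact ⟨hx, hy, hz⟩
  · intro i j k ih x y z h
    obtain ⟨hy, hx, hz⟩ := ih (x := y) (y := x) (z := z) (by rw [← h]; abel)
    exact ⟨hx, hy, hz⟩

theorem Cyc.rotate_iff (x y z : ℝ) : Cyc y z x ↔ Cyc x y z := by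
  unfold Cyc
  tauto

theorem Cyc.swap_iff (x y z : ℝ) : Cyc (-x) (-z) (-y) ↔ Cyc x y z := by
  simp only [Cyc, neg_pos, neg_lt_zero]
  tauto

theorem Cyc.neg_iff (x y z : ℝ) : Cyc (-x) (-y) (-z) ↔ Cyc x y z := by
  simp only [Cyc, neg_pos, neg_lt_zero]
  tauto

theorem form_mul_form_mul_form_neg_iff (S : Seed) (hij : i ≠ j) (hik : i ≠ k) (hjk : j ≠ k)
    (h0 : form (S.v i) (S.v j) * form (S.v j) (S.v k) * form (S.v k) (S.v i) ≠ 0) :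
    form (S.v i) (S.v j) * form (S.v j) (S.v k) * form (S.v k) (S.v i) < 0 ↔
      ¬ Cyc (S.B i j) (S.B j k) (S.B k i) := by
  revert h0
  refine distinct_induction (P := fun i j k =>
    form (S.v i) (S.v j) * form (S.v j) (S.v k) * form (S.v k) (S.v i) ≠ 0 →
    (form (S.v i) (S.v j) * form (S.v j) (S.v k) * form (S.v k) (S.v i) < 0 ↔
      ¬ Cyc (S.B i j) (S.B j k) (S.B k i))) ?_ ?_ ?_ hij hik hjk
  · rw [form_comm (S.v 2), mul_right_comm]
    exact (parity_iff S.skew).1 S.realisation.parity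
  · intro i j k ih
    rwa [Cyc.rotate_iff, ← mul_rotate]
  · intro i j k ih
    rwa [S.B_skew i j, S.B_skew k i, S.B_skew j k, Cyc.swap_iff, form_comm (S.v j) (S.v i),
      form_comm (S.v i) (S.v k), form_comm (S.v k) (S.v j), mul_right_comm]

variable (Pos : AffFun → Prop)

theorem mutate_v_self (S : Seed) (k : Fin 3) : (S.mutate Pos k).v k = -S.v k :=
  if_pos rfl

theorem mutate_B_left (S : Seed) (k j : Fin 3) : (S.mutate Pos k).B k j = -S.B k j := by
  simp [Seed.mutate, mutateMatrix]

theorem mutate_B_right (S : Seed) (i k : Fin 3) : (S.mutate Pos k).B i k = -S.B i k := by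
  simp [Seed.mutate, mutateMatrix]

theorem mutate_B_of_ne (S : Seed) (hik : i ≠ k) (hjk : j ≠ k) :
    (S.mutate Pos k).B i j =
      S.B i j + (S.B i k * |S.B k j| + |S.B i k| * S.B k j) / 2 := by
  simp [Seed.mutate, mutateMatrix, hik, hjk]

variable {Pos}

theorem InExchangeGraph.mutate {S₀ : Seed} (h : InExchangeGraph Pos S₀ S) (k : Fin 3) :
    InExchangeGraph Pos S₀ (S.mutate Pos k) :=
  h.tail ⟨k, rfl⟩

end Seeds

section Coherent

/-- The linear relation between the weights of the quiver and the vectors: with signs, the exchange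
of `v k` in a mutation leaves it unchanged. -/
def kernelVec (S : Seed) (i j k : Fin 3) : AffFun :=
  S.B i j • S.v k + S.B j k • S.v i + S.B k i • S.v j

open Classical in
/-- The sign of `f`: it is `1` if `f` is positive with respect to the point at infinity of the ray
from `p` through `q`, and `-1` otherwise. -/
def beltSign (p q : Plane) (f : AffFun) : ℝ :=
  if IsPositive p q f then 1 else -1

/-- The inner product prescribed by the weight `b` of an arrow from a vector of sign `ε` to a vector
of sign `δ`. For signs in `{1, -1}` this is `-|b|` if `ε = δ` and `b * δ` if `ε ≠ δ`. -/
def signedWeight (b ε δ : ℝ) : ℝ :=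
  (b * (δ - ε) - |b| * (1 + ε * δ)) / 2

/-- The inner products of the vectors of `S` are determined by their signs, and the kernel vector
vanishes on the line through `p` and `q`. -/
structure Coherent (p q : Plane) (S : Seed) : Prop where
  ne_zero : ∀ i j, i ≠ j → S.B i j ≠ 0
  vanishesOn : VanishesOn p q (kernelVec S 0 1 2)
  form_eq : ∀ i j, i ≠ j → form (S.v i) (S.v j) =
    signedWeight (S.B i j) (beltSign p q (S.v i)) (beltSign p q (S.v j))

variable {p q : Plane} {S : Seed} {i j k : Fin 3}

theorem kernelVec_rotate (S : Seed) (i j k : Fin 3) : kernelVec S j k i = kernelVec S i j k := by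
  unfold kernelVec
  abel

theorem kernelVec_swap (S : Seed) (i j k : Fin 3) : kernelVec S j i k = -kernelVec S i j k := by
  unfold kernelVec
  rw [S.B_skew i j, S.B_skew k i, S.B_skew j k]
  module

theorem vanishesOn_kernelVec_iff (hij : i ≠ j) (hik : i ≠ k) (hjk : j ≠ k) :
    VanishesOn p q (kernelVec S i j k) ↔ VanishesOn p q (kernelVec S 0 1 2) := by
  refine distinct_induction (P := fun i j k => VanishesOn p q (kernelVec S i j k) ↔
    VanishesOn p q (kernelVec S 0 1 2)) Iff.rfl ?_ ?_ hij hik hjk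
  · intro i j k ih
    rwa [kernelVec_rotate]
  · intro i j k ih
    rw [kernelVec_swap, ← ih]
    exact ⟨fun h => neg_neg (kernelVec S i j k) ▸ h.neg, VanishesOn.neg⟩

theorem beltSign_of_isPositive {f : AffFun} (h : IsPositive p q f) : beltSign p q f = 1 :=
  if_pos h

theorem beltSign_of_not_isPositive {f : AffFun} (h : ¬ IsPositive p q f) : beltSign p q f = -1 :=
  if_neg h

theorem beltSign_eq_or (p q : Plane) (f : AffFun) : beltSign p q f = 1 ∨ beltSign p q f = -1 :=
  (em (IsPositive p q f)).imp beltSign_of_isPositive beltSign_of_not_isPositive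

theorem beltSign_sq (p q : Plane) (f : AffFun) : beltSign p q f ^ 2 = 1 := by
  rcases beltSign_eq_or p q f with h | h <;> rw [h] <;> norm_num

theorem isPositive_neg_of_not (hpq : p ≠ q) (hne : ∀ i j, i ≠ j → S.B i j ≠ 0)
    (hker : VanishesOn p q (kernelVec S 0 1 2)) (h : ¬ IsPositive p q (S.v i)) :
    IsPositive p q (-S.v i) := by
  by_contra h'
  obtain ⟨j, k, hjk, hji, hki⟩ := exists_distinct i
  obtain ⟨c, hc⟩ := (vanishesOn_of_not_isPositive h h').exists_eq_smul hpq (fst_v_ne_zero S i)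
    ((vanishesOn_kernelVec_iff hji.symm hki.symm hjk).2 hker)
  have hrel : (S.B j k - c) • S.v i + S.B k i • S.v j + S.B i j • S.v k = 0 := by
    rw [sub_smul, ← hc, kernelVec]
    abel
  exact hne i j hji.symm (eq_zero_of_smul_add_smul_add_smul hji.symm hki.symm hjk hrel).2.2

theorem beltSign_neg (hpq : p ≠ q) (hne : ∀ i j, i ≠ j → S.B i j ≠ 0)
    (hker : VanishesOn p q (kernelVec S 0 1 2)) :
    beltSign p q (-S.v i) = -beltSign p q (S.v i) := by
  by_cases h : IsPositive p q (S.v i)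
  · rw [beltSign_of_isPositive h, beltSign_of_not_isPositive h.not_neg]
  · rw [beltSign_of_not_isPositive h, neg_neg,
      beltSign_of_isPositive (isPositive_neg_of_not hpq hne hker h)]

theorem eventually_beltSign_mul_neg (hpq : p ≠ q) (hne : ∀ i j, i ≠ j → S.B i j ≠ 0)
    (hker : VanishesOn p q (kernelVec S 0 1 2)) (i : Fin 3) :
    ∀ᶠ s : ℝ in atTop, beltSign p q (S.v i) * (S.v i).eval (AffineMap.lineMap p q s) < 0 := by
  by_cases h : IsPositive p q (S.v i)
  · filter_upwards [h] with s hs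
    rwa [beltSign_of_isPositive h, one_mul]
  · filter_upwards [isPositive_neg_of_not hpq hne hker h] with s hs
    rwa [beltSign_of_not_isPositive h, neg_one_mul, ← eval_neg]

/-- Far out on the belt the values of the three vectors have known signs, and the kernel vector is a
combination of them which vanishes there. -/
theorem not_cyc_mul_beltSign (hpq : p ≠ q) (hne : ∀ i j, i ≠ j → S.B i j ≠ 0)
    (hker : VanishesOn p q (kernelVec S 0 1 2)) (hij : i ≠ j) (hik : i ≠ k) (hjk : j ≠ k) :
    ¬ Cyc (S.B j k * beltSign p q (S.v i)) (S.B k i * beltSign p q (S.v j))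
      (S.B i j * beltSign p q (S.v k)) := by
  have hev := eventually_beltSign_mul_neg hpq hne hker
  obtain ⟨s, hi, hj, hk⟩ := ((hev i).and ((hev j).and (hev k))).exists
  have hzero := ((vanishesOn_kernelVec_iff hij hik hjk).2 hker).eval_lineMap s
  rw [kernelVec, eval_add, eval_add, eval_smul, eval_smul, eval_smul] at hzero
  set x := AffineMap.lineMap p q s
  have hsum : S.B j k * beltSign p q (S.v i) * (beltSign p q (S.v i) * (S.v i).eval x) +
      S.B k i * beltSign p q (S.v j) * (beltSign p q (S.v j) * (S.v j).eval x) +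
      S.B i j * beltSign p q (S.v k) * (beltSign p q (S.v k) * (S.v k).eval x) = 0 := by
    linear_combination hzero + S.B j k * (S.v i).eval x * beltSign_sq p q (S.v i) +
      S.B k i * (S.v j).eval x * beltSign_sq p q (S.v j) +
      S.B i j * (S.v k).eval x * beltSign_sq p q (S.v k)
  rintro (⟨ci, cj, ck⟩ | ⟨ci, cj, ck⟩)
  · linarith [mul_neg_of_pos_of_neg ci hi, mul_neg_of_pos_of_neg cj hj,
      mul_neg_of_pos_of_neg ck hk]
  · linarith [mul_pos_of_neg_of_neg ci hi, mul_pos_of_neg_of_neg cj hj,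
      mul_pos_of_neg_of_neg ck hk]

theorem signedWeight_neg (b ε δ : ℝ) : signedWeight (-b) ε δ = signedWeight b δ ε := by
  rw [signedWeight, signedWeight, abs_neg]
  ring

theorem signedWeight_self (b : ℝ) {ε : ℝ} (hε : ε ^ 2 = 1) : signedWeight b ε ε = -|b| := by
  rw [signedWeight]
  linear_combination -|b| / 2 * hε

theorem signedWeight_neg_left (b : ℝ) {δ : ℝ} (hδ : δ ^ 2 = 1) :
    signedWeight b (-δ) δ = b * δ := by
  rw [signedWeight]
  linear_combination |b| / 2 * hδ

theorem signedWeight_neg_right (b : ℝ) {ε : ℝ} (hε : ε ^ 2 = 1) :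
    signedWeight b ε (-ε) = -(b * ε) := by
  rw [signedWeight]
  linear_combination |b| / 2 * hε

theorem abs_signedWeight (b : ℝ) {ε δ : ℝ} (hε : ε ^ 2 = 1) (hδ : δ ^ 2 = 1) :
    |signedWeight b ε δ| = |b| := by
  rcases sq_eq_sq_iff_eq_or_eq_neg.1 (hε.trans hδ.symm) with rfl | rfl
  · rw [signedWeight_self b hδ, abs_neg, abs_abs]
  · rw [signedWeight_neg_left b hδ]
    rcases sq_eq_one_iff.1 hδ with rfl | rfl <;> simp

theorem abs_mul_mul_neg_iff {x y z : ℝ} (hx : x ≠ 0) (hy : y ≠ 0) (hz : z ≠ 0)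
    (h : ¬ Cyc y z (-x)) : |x| * (y * z) < 0 ↔ ¬ Cyc x y z := by
  rw [← smul_eq_mul, smul_neg_iff_of_pos_left (abs_pos.2 hx), mul_neg_iff]
  simp only [Cyc, neg_pos, neg_lt_zero] at h ⊢
  rcases hx.lt_or_gt with hx | hx <;> rcases hy.lt_or_gt with hy | hy <;>
    rcases hz.lt_or_gt with hz | hz <;>
    simp [hx, hy, hz, hx.le.not_gt, hy.le.not_gt, hz.le.not_gt] at h ⊢

theorem Cyc.mul_right_iff {ε : ℝ} (hε : ε ^ 2 = 1) (x y z : ℝ) :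
    Cyc (x * ε) (y * ε) (z * ε) ↔ Cyc x y z := by
  rcases sq_eq_one_iff.1 hε with rfl | rfl
  · simp only [mul_one]
  · simp only [mul_neg_one, Cyc.neg_iff]

/-- Up to rotation, either the three signs agree or only the last one differs. -/
theorem signedWeight_mul_neg_iff {x y z ε δ τ : ℝ} (hx : x ≠ 0) (hy : y ≠ 0) (hz : z ≠ 0)
    (hε : ε ^ 2 = 1) (hδ : δ ^ 2 = 1) (hτ : τ ^ 2 = 1)
    (h : ¬ Cyc (y * ε) (z * δ) (x * τ)) :
    signedWeight x ε δ * signedWeight y δ τ * signedWeight z τ ε < 0 ↔ ¬ Cyc x y z := by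
  rcases sq_eq_sq_iff_eq_or_eq_neg.1 (hδ.trans hε.symm) with rfl | rfl <;>
    rcases sq_eq_sq_iff_eq_or_eq_neg.1 (hτ.trans hε.symm) with rfl | rfl
  · rw [Cyc.mul_right_iff hε, Cyc.rotate_iff] at h
    simp only [signedWeight_self _ hε, h, not_false_eq_true, iff_true]
    have := mul_pos (mul_pos (abs_pos.2 hx) (abs_pos.2 hy)) (abs_pos.2 hz)
    linarith
  · rw [mul_neg, ← neg_mul, Cyc.mul_right_iff hε] at h
    rw [signedWeight_self _ hε, signedWeight_neg_right _ hε, signedWeight_neg_left _ hε,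
      ← abs_mul_mul_neg_iff hx hy hz h]
    exact iff_of_eq (congrArg (· < 0) (by linear_combination |x| * y * z * hε))
  · rw [mul_neg, ← neg_mul, Cyc.mul_right_iff hε, ← Cyc.rotate_iff, ← Cyc.rotate_iff] at h
    rw [signedWeight_neg_right _ hε, signedWeight_neg_left _ hε, signedWeight_self _ hε,
      ← Cyc.rotate_iff, ← Cyc.rotate_iff, ← abs_mul_mul_neg_iff hz hx hy h]
    exact iff_of_eq (congrArg (· < 0) (by linear_combination |z| * x * y * hε))
  · rw [mul_neg, ← neg_mul, mul_neg, ← neg_mul, Cyc.mul_right_iff hε, ← neg_neg y, Cyc.neg_iff,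
      Cyc.rotate_iff, Cyc.rotate_iff, ← Cyc.rotate_iff, ← Cyc.rotate_iff, ← Cyc.rotate_iff] at h
    rw [signedWeight_neg_right _ hε, signedWeight_self _ hτ, signedWeight_neg_left _ hε,
      ← Cyc.rotate_iff, ← abs_mul_mul_neg_iff hy hz hx h]
    exact iff_of_eq (congrArg (· < 0) (by linear_combination |y| * z * x * hε))

theorem eq_of_abs_eq_of_mul_neg_iff {x y c : ℝ} (h : |x| = |y|) (hx : x ≠ 0) (hc : c ≠ 0)
    (hneg : x * c < 0 ↔ y * c < 0) : x = y := by
  refine (abs_eq_abs.1 h).resolve_right ?_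
  rintro rfl
  have hyc : y * c ≠ 0 := mul_ne_zero (neg_ne_zero.1 hx) hc
  rw [neg_mul, neg_lt_zero] at hneg
  rcases hyc.lt_or_gt with hlt | hlt
  · exact hlt.asymm (hneg.2 hlt)
  · exact hlt.asymm (hneg.1 hlt)

theorem form_v_ne_zero (hne : ∀ i j, i ≠ j → S.B i j ≠ 0) (hij : i ≠ j) :
    form (S.v i) (S.v j) ≠ 0 := by
  rw [← abs_pos, S.realisation.abs_form i j hij, abs_pos]
  exact hne i j hij

theorem form_eq_signedWeight_symm (h : form (S.v i) (S.v j) =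
      signedWeight (S.B i j) (beltSign p q (S.v i)) (beltSign p q (S.v j))) :
    form (S.v j) (S.v i) =
      signedWeight (S.B j i) (beltSign p q (S.v j)) (beltSign p q (S.v i)) := by
  rw [form_comm, h, S.B_skew i j, signedWeight_neg]

/-- The sign of the third inner product follows from the parity condition. -/
theorem form_eq_signedWeight_of_form_eq (hpq : p ≠ q) (hne : ∀ i j, i ≠ j → S.B i j ≠ 0)
    (hker : VanishesOn p q (kernelVec S 0 1 2)) (hij : i ≠ j) (hik : i ≠ k) (hjk : j ≠ k)
    (hi : form (S.v i) (S.v k) =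
      signedWeight (S.B i k) (beltSign p q (S.v i)) (beltSign p q (S.v k)))
    (hj : form (S.v j) (S.v k) =
      signedWeight (S.B j k) (beltSign p q (S.v j)) (beltSign p q (S.v k))) :
    form (S.v i) (S.v j) =
      signedWeight (S.B i j) (beltSign p q (S.v i)) (beltSign p q (S.v j)) := by
  have fij := form_v_ne_zero hne hij
  have fjk := form_v_ne_zero hne hjk
  have fki := form_v_ne_zero hne hik.symm
  refine eq_of_abs_eq_of_mul_neg_iff ?_ fij (mul_ne_zero fjk fki) ?_
  · rw [S.realisation.abs_form i j hij,
      abs_signedWeight _ (beltSign_sq p q _) (beltSign_sq p q _)]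
  · rw [← mul_assoc, form_mul_form_mul_form_neg_iff S hij hik hjk
      (mul_ne_zero (mul_ne_zero fij fjk) fki), hj, form_eq_signedWeight_symm hi, ← mul_assoc,
      signedWeight_mul_neg_iff (hne i j hij) (hne j k hjk) (hne k i hik.symm) (beltSign_sq p q _)
        (beltSign_sq p q _) (beltSign_sq p q _)
        (not_cyc_mul_beltSign hpq hne hker hij hik hjk)]

theorem Coherent.of_form_eq (hpq : p ≠ q) (hne : ∀ i j, i ≠ j → S.B i j ≠ 0)
    (hker : VanishesOn p q (kernelVec S 0 1 2)) (k : Fin 3)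
    (h : ∀ i, i ≠ k → form (S.v i) (S.v k) =
      signedWeight (S.B i k) (beltSign p q (S.v i)) (beltSign p q (S.v k))) :
    Coherent p q S := by
  refine ⟨hne, hker, fun i j hij => ?_⟩
  by_cases hik : i = k
  · subst hik
    exact form_eq_signedWeight_symm (h j hij.symm)
  · by_cases hjk : j = k
    · subst hjk
      exact h i hij
    · exact form_eq_signedWeight_of_form_eq hpq hne hker hij hik hjk (h i hik) (h j hjk)

theorem abs_eq_abs_beltSign_mul (f : AffFun) (b : ℝ) : |b| = |beltSign p q f * b| := by
  rcases beltSign_eq_or p q f with h | h <;> simp [h]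

theorem beltSign_mul_neg_iff (f : AffFun) (b : ℝ) : beltSign p q f * b < 0 ↔
    (IsPositive p q f ∧ b < 0) ∨ (¬ IsPositive p q f ∧ 0 < b) := by
  by_cases h : IsPositive p q f <;> simp [beltSign, h]

theorem Coherent.mutate_v (hS : Coherent p q S) (hik : i ≠ k) :
    (S.mutate (IsPositive p q) k).v i =
      S.v i - ((beltSign p q (S.v k) * S.B i k - |S.B i k|) / 2) • S.v k := by
  obtain ⟨c, -, hc, hcc⟩ := mutateVectors_eq (IsPositive p q) (v := S.v) (B := S.B) k
  refine (hc i).trans (congrArg (fun x : ℝ => S.v i - x • S.v k) ?_)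
  have hform := hS.form_eq i k hik
  have habs := abs_eq_abs_beltSign_mul (p := p) (q := q) (S.v k) (S.B i k)
  rcases hcc i hik with ⟨hmove, hci⟩ | ⟨hstay, hci⟩
  · rw [abs_of_neg ((beltSign_mul_neg_iff _ _).2 hmove)] at habs
    rw [hci, hform, signedWeight, habs]
    linear_combination S.B i k * beltSign p q (S.v i) / 2 * beltSign_sq p q (S.v k)
  · rw [← beltSign_mul_neg_iff, not_lt] at hstay
    rw [hci, habs, abs_of_nonneg hstay, sub_self, zero_div]

theorem Coherent.abs_eq_or_mutate_v_eq (hS : Coherent p q S) (hik : i ≠ k) :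
    |S.B i k| = -(beltSign p q (S.v k) * S.B i k) ∨
      (S.mutate (IsPositive p q) k).v i = S.v i := by
  rw [hS.mutate_v hik, abs_eq_abs_beltSign_mul (p := p) (q := q) (S.v k) (S.B i k)]
  rcases abs_choice (beltSign p q (S.v k) * S.B i k) with h | h
  · exact Or.inr (by rw [h, sub_self, zero_div, zero_smul, sub_zero])
  · exact Or.inl h

theorem Coherent.kernelVec_mutate (hS : Coherent p q S) (hik : i ≠ k) (hjk : j ≠ k) :
    kernelVec (S.mutate (IsPositive p q) k) i j k = -kernelVec S i j k := by
  unfold kernelVec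
  rw [mutate_B_right, mutate_B_left, mutate_B_of_ne _ _ hik hjk, hS.mutate_v hik, hS.mutate_v hjk,
    mutate_v_self, S.B_skew j k, S.B_skew i k, abs_neg]
  module

theorem Coherent.mutate (hpq : p ≠ q) (hS : Coherent p q S) (k : Fin 3)
    (hne : ∀ i j, i ≠ j → (S.mutate (IsPositive p q) k).B i j ≠ 0) :
    Coherent p q (S.mutate (IsPositive p q) k) := by
  have hker : VanishesOn p q (kernelVec (S.mutate (IsPositive p q) k) 0 1 2) := by
    obtain ⟨i, j, hij, hik, hjk⟩ := exists_distinct k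
    rw [← vanishesOn_kernelVec_iff hij hik hjk, hS.kernelVec_mutate hik hjk]
    exact ((vanishesOn_kernelVec_iff hij hik hjk).2 hS.vanishesOn).neg
  refine Coherent.of_form_eq hpq hne hker k fun i hik => ?_
  have hneg := form_sub_smul (S.v i) (S.v k) (S.v k)
    ((beltSign p q (S.v k) * S.B i k - |S.B i k|) / 2) 2
  rw [← hS.mutate_v hik, show S.v k - (2 : ℝ) • S.v k = -S.v k by module,
    S.realisation.form_self, hS.form_eq i k hik] at hneg
  rw [mutate_v_self, mutate_B_right, beltSign_neg hpq hS.ne_zero hS.vanishesOn, hneg,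
    signedWeight, signedWeight, abs_neg]
  rcases hS.abs_eq_or_mutate_v_eq hik with h | h
  · rw [h]
    linear_combination (beltSign p q ((S.mutate (IsPositive p q) k).v i) - beltSign p q (S.v i)) *
      S.B i k / 2 * beltSign_sq p q (S.v k)
  · rw [h]
    ring

end Coherent

section Weight

/-- The weight `2 cos (j (π + α))`, which is periodic in `j` with period `2n+1`. -/
def weight (n : ℕ) (j : ℤ) : ℝ := 2 * Real.cos (j * (Real.pi + alpha n))

theorem weight_neg (n : ℕ) (j : ℤ) : weight n (-j) = weight n j := by
  unfold weight
  push_cast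
  rw [neg_mul, Real.cos_neg]

theorem weight_zero (n : ℕ) : weight n 0 = 2 := by simp [weight]

theorem weight_add_mul (n : ℕ) (j m : ℤ) : weight n (j + m * (2 * n + 1)) = weight n j := by
  unfold weight
  have : ((j + m * (2 * n + 1) : ℤ) : ℝ) * (Real.pi + alpha n) =
      j * (Real.pi + alpha n) + (m * (n + 1) : ℤ) * (2 * Real.pi) := by
    push_cast
    linear_combination (m : ℝ) * mul_alpha n
  rw [this, Real.cos_add_int_mul_two_pi]

theorem weight_mul (n : ℕ) (a b : ℤ) :
    weight n a * weight n b = weight n (a + b) + weight n (a + -b) := by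
  unfold weight
  push_cast
  rw [add_mul, add_mul, neg_mul, ← sub_eq_add_neg, Real.cos_add, Real.cos_sub]
  ring

theorem weight_eq (n : ℕ) (j : ℕ) : weight n j = (-1) ^ j * (2 * Real.cos (j * alpha n)) := by
  unfold weight
  rw [Int.cast_natCast, mul_add, add_comm, Real.cos_add_nat_mul_pi]
  ring

theorem weight_ne_zero (n : ℕ) (j : ℤ) : weight n j ≠ 0 := by
  intro h
  unfold weight at h
  rw [mul_eq_zero, Real.cos_eq_zero_iff] at h
  obtain ⟨k, hk⟩ := h.resolve_left two_ne_zero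
  have h1 : (2 * j * (2 * n + 2) - (2 * k + 1) * (2 * n + 1) : ℝ) * alpha n = 0 := by
    linear_combination 2 * hk + (2 * j - (2 * k + 1)) * mul_alpha n
  have h2 := (mul_eq_zero.1 h1).resolve_right (alpha_pos n).ne'
  have h3 : (2 * j * (2 * n + 2) - (2 * k + 1) * (2 * n + 1) : ℤ) = 0 := by exact_mod_cast h2
  have h4 : 2 * (j * (2 * n + 2) - k * (2 * n + 1) - n) = (1 : ℤ) := by linear_combination h3
  omega

theorem weight_mem (n : ℕ) (j : ℤ) : weight n j ∈ cosRing n := by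
  have h1 : 2 * Real.cos (Real.pi + alpha n) ∈ cosRing n := by
    rw [add_comm, Real.cos_add_pi, mul_neg]
    exact Subalgebra.neg_mem _ (two_cos_alpha_mem n)
  have h2 := two_cos_mul_mem h1 j.natAbs
  have h3 : weight n j = weight n j.natAbs := by
    rcases Int.natAbs_eq j with h | h <;> conv_lhs => rw [h]
    rw [weight_neg]
  rw [h3, weight, Int.cast_natCast]
  exact h2

end Weight

section Class

variable {n : ℕ} {S : Seed} {i j k l m : Fin 3} {a b : ℤ} {Pos : AffFun → Prop}

/-- Mutation at `j` replaces `v i` by `v i - x • v j` and `v k` by `v k - y • v j`. If `i → j → k`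
or `k → j → i`, then exactly one of these is a reflection, otherwise both or neither of them are. -/
theorem exists_form_mutate (Pos : AffFun → Prop) (S : Seed) (hij : i ≠ j) (hjk : j ≠ k) :
    ∃ x y : ℝ,
      form ((S.mutate Pos j).v i) ((S.mutate Pos j).v j) = 2 * x - form (S.v i) (S.v j) ∧
      form ((S.mutate Pos j).v j) ((S.mutate Pos j).v k) = 2 * y - form (S.v j) (S.v k) ∧
      form ((S.mutate Pos j).v k) ((S.mutate Pos j).v i) = form (S.v k) (S.v i) -
        x * form (S.v j) (S.v k) - y * form (S.v i) (S.v j) + 2 * x * y ∧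
      (0 < S.B i j * S.B j k →
        x = form (S.v i) (S.v j) ∧ y = 0 ∨ x = 0 ∧ y = form (S.v j) (S.v k)) ∧
      (S.B i j * S.B j k < 0 →
        x = form (S.v i) (S.v j) ∧ y = form (S.v j) (S.v k) ∨ x = 0 ∧ y = 0) := by
  obtain ⟨c, hcj, hc, hcc⟩ := mutateVectors_eq Pos (v := S.v) (B := S.B) j
  have hv : ∀ m, (S.mutate Pos j).v m = S.v m - c m • S.v j := hc
  have hi := hcc i hij
  have hk := hcc k hjk.symm
  rw [S.B_skew j k, form_comm (S.v k)] at hk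
  refine ⟨c i, c k, ?_, ?_, ?_, ?_, ?_⟩
  · rw [hv, hv, form_sub_smul, S.realisation.form_self, hcj]
    ring
  · rw [hv, hv, form_sub_smul, S.realisation.form_self, hcj, form_comm (S.v k)]
    ring
  · rw [hv, hv, form_sub_smul, S.realisation.form_self, form_comm (S.v k) (S.v j)]
    ring
  · intro hpos
    rcases pos_and_pos_or_neg_and_neg_of_mul_pos hpos with ⟨h1, h2⟩ | ⟨h1, h2⟩ <;>
      by_cases hp : Pos (S.v j) <;> simp_all [h1.le.not_gt, h2.le.not_gt]
  · intro hneg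
    rcases mul_neg_iff.1 hneg with ⟨h1, h2⟩ | ⟨h1, h2⟩ <;>
      by_cases hp : Pos (S.v j) <;> simp_all [h1.le.not_gt, h2.le.not_gt]

/-- The inner products of `v i`, `v j`, `v k` are, up to changes of sign of an even number of them,
the weights at `a`, `b` and `a + b`. -/
structure HasClass (n : ℕ) (S : Seed) (i j k : Fin 3) (a b : ℤ) : Prop where
  hij : i ≠ j
  hik : i ≠ k
  hjk : j ≠ k
  sq_left : form (S.v i) (S.v j) ^ 2 = weight n a ^ 2
  sq_right : form (S.v j) (S.v k) ^ 2 = weight n b ^ 2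
  sq_sum : form (S.v k) (S.v i) ^ 2 = weight n (a + b) ^ 2
  prod : form (S.v i) (S.v j) * form (S.v j) (S.v k) * form (S.v k) (S.v i) =
    weight n a * weight n b * weight n (a + b)

namespace HasClass

theorem rotate (h : HasClass n S i j k a b) : HasClass n S j k i b (-a - b) := by
  have hright : weight n (-a - b) = weight n (a + b) := by
    rw [← weight_neg, neg_sub', neg_neg, sub_neg_eq_add]
  have hsum : weight n (b + (-a - b)) = weight n a := by
    rw [add_sub_cancel, weight_neg]
  refine ⟨h.hjk, h.hij.symm, h.hik.symm, h.sq_right, ?_, ?_, ?_⟩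
  · rw [hright, h.sq_sum]
  · rw [hsum, h.sq_left]
  · rw [hright, hsum, ← mul_rotate, h.prod]
    ring

theorem swap (h : HasClass n S i j k a b) : HasClass n S k j i b a := by
  refine ⟨h.hjk.symm, h.hik.symm, h.hij.symm, ?_, ?_, ?_, ?_⟩
  · rw [form_comm, h.sq_right]
  · rw [form_comm, h.sq_left]
  · rw [form_comm, add_comm, h.sq_sum]
  · rw [form_comm (S.v k) (S.v j), form_comm (S.v j) (S.v i), form_comm (S.v i) (S.v k),
      add_comm b, mul_comm (weight n b), ← h.prod, mul_comm (form (S.v j) (S.v k))]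

theorem congr {a' b' : ℤ} (h : HasClass n S i j k a b) (ha : weight n a' = weight n a)
    (hb : weight n b' = weight n b) (hab : weight n (a' + b') = weight n (a + b)) :
    HasClass n S i j k a' b' :=
  ⟨h.hij, h.hik, h.hjk, ha ▸ h.sq_left, hb ▸ h.sq_right, hab ▸ h.sq_sum,
    ha ▸ hb ▸ hab ▸ h.prod⟩

theorem neg (h : HasClass n S i j k a b) : HasClass n S i j k (-a) (-b) :=
  h.congr (weight_neg n a) (weight_neg n b) (by rw [← neg_add, weight_neg])

theorem exists_form_sq_eq (h : HasClass n S i j k a b) (hlm : l ≠ m) :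
    ∃ c : ℤ, form (S.v l) (S.v m) ^ 2 = weight n c ^ 2 := by
  rcases eq_or_eq_or_eq h.hij h.hik h.hjk l with rfl | rfl | rfl <;>
    rcases eq_or_eq_or_eq h.hij h.hik h.hjk m with rfl | rfl | rfl
  all_goals first
    | exact absurd rfl hlm
    | exact ⟨_, h.sq_left⟩
    | exact ⟨_, h.sq_right⟩
    | exact ⟨_, h.sq_sum⟩
    | exact ⟨_, h.swap.sq_left⟩
    | exact ⟨_, h.swap.sq_right⟩
    | exact ⟨_, h.swap.sq_sum⟩

theorem form_mem (h : HasClass n S i j k a b) (hlm : l ≠ m) :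
    form (S.v l) (S.v m) ∈ cosRing n := by
  obtain ⟨c, hc⟩ := h.exists_form_sq_eq hlm
  rcases sq_eq_sq_iff_eq_or_eq_neg.1 hc with hc | hc <;> rw [hc]
  · exact weight_mem n c
  · exact neg_mem (weight_mem n c)

theorem B_ne_zero (h : HasClass n S i j k a b) (hlm : l ≠ m) : S.B l m ≠ 0 := by
  obtain ⟨c, hc⟩ := h.exists_form_sq_eq hlm
  rw [← abs_pos, ← S.realisation.abs_form l m hlm, abs_pos, ← sq_pos_iff, hc, sq_pos_iff]
  exact weight_ne_zero n c

theorem mutate_of_pos (h : HasClass n S i j k a b) (hpos : 0 < S.B i j * S.B j k) :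
    HasClass n (S.mutate Pos j) i j k a (-b) := by
  obtain ⟨x, y, hij, hjk, hki, hxy, -⟩ := exists_form_mutate Pos S h.hij h.hjk
  have hsum : weight n (a + -b) = weight n a * weight n b - weight n (a + b) := by
    rw [weight_mul, add_sub_cancel_left]
  have hl := h.sq_left
  have hr := h.sq_right
  have hs := h.sq_sum
  have hp := h.prod
  refine ⟨h.hij, h.hik, h.hjk, ?_, ?_, ?_, ?_⟩ <;>
    rcases hxy hpos with ⟨rfl, rfl⟩ | ⟨rfl, rfl⟩
  all_goals
    simp only [hij, hjk, hki, hsum, weight_neg]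
    grind

theorem mutate_of_neg (h : HasClass n S i j k a b) (hneg : S.B i j * S.B j k < 0) :
    HasClass n (S.mutate Pos j) i j k a b := by
  obtain ⟨x, y, hij, hjk, hki, -, hxy⟩ := exists_form_mutate Pos S h.hij h.hjk
  have hl := h.sq_left
  have hr := h.sq_right
  have hs := h.sq_sum
  have hp := h.prod
  refine ⟨h.hij, h.hik, h.hjk, ?_, ?_, ?_, ?_⟩ <;>
    rcases hxy hneg with ⟨rfl, rfl⟩ | ⟨rfl, rfl⟩
  all_goals
    simp only [hij, hjk, hki]
    grind

theorem exists_mutate_middle (h : HasClass n S i j k a b) :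
    ∃ b', HasClass n (S.mutate Pos j) i j k a b' := by
  rcases (mul_ne_zero (h.B_ne_zero h.hij) (h.B_ne_zero h.hjk)).lt_or_gt with hlt | hgt
  · exact ⟨b, h.mutate_of_neg hlt⟩
  · exact ⟨-b, h.mutate_of_pos hgt⟩

theorem exists_mutate (h : HasClass n S i j k a b) (m : Fin 3) :
    ∃ i' j' k' a' b', HasClass n (S.mutate Pos m) i' j' k' a' b' := by
  rcases eq_or_eq_or_eq h.hij h.hik h.hjk m with rfl | rfl | rfl
  · exact ⟨_, _, _, _, h.rotate.rotate.exists_mutate_middle⟩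
  · exact ⟨_, _, _, _, h.exists_mutate_middle⟩
  · exact ⟨_, _, _, _, h.rotate.exists_mutate_middle⟩

end HasClass

theorem mutate_B_of_mul_neg (hij : i ≠ j) (hjk : j ≠ k) (hneg : S.B i j * S.B j k < 0) :
    (S.mutate Pos j).B k i = S.B k i := by
  rw [mutate_B_of_ne _ _ hjk.symm hij, S.B_skew j k, S.B_skew i j, abs_neg, abs_neg]
  rcases mul_neg_iff.1 hneg with ⟨h1, h2⟩ | ⟨h1, h2⟩
  · rw [abs_of_pos h1, abs_of_neg h2]
    ring
  · rw [abs_of_neg h1, abs_of_pos h2]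
    ring

/-- The exchange graph of `S₀` contains a seed of class `(a, b)`. -/
def Reachable (n : ℕ) (Pos : AffFun → Prop) (S₀ : Seed) (a b : ℤ) : Prop :=
  ∃ S i j k, InExchangeGraph Pos S₀ S ∧ HasClass n S i j k a b

namespace Reachable

variable {S₀ : Seed}

theorem rotate (h : Reachable n Pos S₀ a b) : Reachable n Pos S₀ b (-a - b) := by
  obtain ⟨S, i, j, k, hS, h⟩ := h
  exact ⟨S, j, k, i, hS, h.rotate⟩

theorem swap (h : Reachable n Pos S₀ a b) : Reachable n Pos S₀ b a := by
  obtain ⟨S, i, j, k, hS, h⟩ := h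
  exact ⟨S, k, j, i, hS, h.swap⟩

theorem of_mul_pos (hS : InExchangeGraph Pos S₀ S) (h : HasClass n S i j k a b)
    (hpos : 0 < S.B i j * S.B j k) : Reachable n Pos S₀ a (-b) :=
  ⟨_, i, j, k, hS.mutate j, h.mutate_of_pos hpos⟩

theorem neg (h : Reachable n Pos S₀ a b) : Reachable n Pos S₀ (-a) (-b) := by
  obtain ⟨S, i, j, k, hS, h⟩ := h
  exact ⟨S, i, j, k, hS, h.neg⟩

/-- If `i` and `j` are a source and a sink, mutation at `i` makes `j` a middle vertex without
changing the class. -/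
theorem of_mul_neg (hS : InExchangeGraph Pos S₀ S) (h : HasClass n S i j k a b)
    (hj : S.B i j * S.B j k < 0) (hi : S.B k i * S.B i j < 0) : Reachable n Pos S₀ a (-b) := by
  have h' := (h.rotate.rotate.mutate_of_neg (Pos := Pos) hi).rotate
  rw [show -b - (-a - b) = a by ring, show -(-a - b) - a = b by ring] at h'
  refine of_mul_pos (hS.mutate i) h' ?_
  rw [mutate_B_left, mutate_B_of_mul_neg h.hik.symm h.hij hi]
  linarith

theorem neg_right (h : Reachable n Pos S₀ a b) : Reachable n Pos S₀ a (-b) := by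
  obtain ⟨S, i, j, k, hS, h⟩ := h
  have nij := h.B_ne_zero h.hij
  have njk := h.B_ne_zero h.hjk
  have nki := h.B_ne_zero h.hik.symm
  rcases (mul_ne_zero nij njk).lt_or_gt with hj | hj
  · rcases (mul_ne_zero nki nij).lt_or_gt with hi | hi
    · exact of_mul_neg hS h hj hi
    · have hk : S.B j k * S.B k i < 0 := by
        refine (mul_ne_zero njk nki).lt_or_gt.resolve_right fun hk => ?_
        nlinarith [mul_pos hi hk, sq_pos_of_ne_zero nki]
      rw [← neg_neg a]
      refine (of_mul_neg hS h.swap ?_ ?_).swap.neg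
      · rwa [S.B_skew j k, S.B_skew i j, neg_mul_neg, mul_comm]
      · rwa [S.B_skew j k, S.B_skew k i, neg_mul_neg, mul_comm]
  · exact of_mul_pos hS h hj

theorem add_right (h : Reachable n Pos S₀ a b) : Reachable n Pos S₀ a (b + a) := by
  have := h.swap.rotate.neg_right
  rwa [show -(-b - a) = b + a by ring] at this

theorem sub_right (h : Reachable n Pos S₀ a b) : Reachable n Pos S₀ a (b - a) := by
  have := h.neg_right.add_right.neg_right
  rwa [show -(-b + a) = b - a by ring] at this

theorem add_mul_right (h : Reachable n Pos S₀ a b) (m : ℤ) :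
    Reachable n Pos S₀ a (b + m * a) := by
  induction m using Int.induction_on with
  | zero => simpa using h
  | succ m ih =>
    have := ih.add_right
    rwa [show b + (m : ℤ) * a + a = b + (m + 1) * a by ring] at this
  | pred m ih =>
    have := ih.sub_right
    rwa [show b + -(m : ℤ) * a - a = b + (-m - 1) * a by ring] at this

theorem periodic (h : Reachable n Pos S₀ a b) (m : ℤ) :
    Reachable n Pos S₀ a (b + m * (2 * n + 1)) := by
  obtain ⟨S, i, j, k, hS, h⟩ := h
  refine ⟨S, i, j, k, hS, h.congr rfl (weight_add_mul _ _ _) ?_⟩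
  rw [← add_assoc, weight_add_mul]

theorem iff_gcd (c d : ℕ) : Reachable n Pos S₀ c d ↔ Reachable n Pos S₀ (Nat.gcd c d) 0 := by
  induction c, d using Nat.gcd.induction with
  | H0 d => rw [Nat.gcd_zero_left]; exact ⟨swap, swap⟩
  | H1 c d _ ih =>
    rw [Nat.gcd_rec, ← ih]
    have e : (d : ℤ) = (d % c : ℕ) + (d / c : ℕ) * (c : ℤ) := by
      exact_mod_cast (Nat.mod_add_div' d c).symm
    constructor
    · intro h
      have := (h.add_mul_right (-(d / c : ℕ))).swap
      rwa [show (d : ℤ) + -((d / c : ℕ) : ℤ) * c = (d % c : ℕ) by linear_combination e] at this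
    · intro h
      rw [e]
      exact h.swap.add_mul_right _

theorem of_coprime {c k : ℕ} (hc : Nat.gcd c (2 * n + 1) = 1) (hk : Nat.gcd k (2 * n + 1) = 1)
    (h : Reachable n Pos S₀ c 0) : Reachable n Pos S₀ k 0 := by
  have h1 : Reachable n Pos S₀ c (2 * n + 1 : ℕ) := by simpa using h.periodic 1
  rw [iff_gcd, hc, ← hk, ← iff_gcd] at h1
  simpa using h1.periodic (-1)

end Reachable

end Class

section Mutation

theorem span_mutate (A : Subalgebra ℤ ℝ) (Pos : AffFun → Prop) (S : Seed) (k : Fin 3)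
    (hA : ∀ i, i ≠ k → form (S.v i) (S.v k) ∈ A) :
    Submodule.span A (Set.range (S.mutate Pos k).v) = Submodule.span A (Set.range S.v) := by
  obtain ⟨c, hck, hc, hcc⟩ := mutateVectors_eq Pos (v := S.v) (B := S.B) k
  have hmut : ∀ i, (S.mutate Pos k).v i = S.v i - c i • S.v k := hc
  have hcA : ∀ i, c i ∈ A := by
    intro i
    by_cases hi : i = k
    · rw [hi, hck]
      exact ofNat_mem A 2
    · rcases hcc i hi with ⟨-, h⟩ | ⟨-, h⟩ <;> rw [h]
      exacts [hA i hi, A.zero_mem]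
  have hinv : ∀ i, S.v i = (S.mutate Pos k).v i - c i • (S.mutate Pos k).v k := by
    intro i
    rw [mutate_v_self, hmut]
    module
  refine le_antisymm (Submodule.span_le.2 ?_) (Submodule.span_le.2 ?_) <;> rintro _ ⟨i, rfl⟩
  · rw [hmut]
    exact Submodule.sub_mem _ (Submodule.subset_span ⟨i, rfl⟩)
      (Submodule.smul_mem _ (⟨c i, hcA i⟩ : A) (Submodule.subset_span ⟨k, rfl⟩))
  · rw [hinv]
    exact Submodule.sub_mem _ (Submodule.subset_span ⟨i, rfl⟩)
      (Submodule.smul_mem _ (⟨c i, hcA i⟩ : A) (Submodule.subset_span ⟨k, rfl⟩))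

/-- The volume form on affine functions, as a determinant in the coordinates of the plane. -/
def vol (f g h : AffFun) : ℝ :=
  f.1 0 * (g.1 1 * h.2 - g.2 * h.1 1) - f.1 1 * (g.1 0 * h.2 - g.2 * h.1 0) +
    f.2 * (g.1 0 * h.1 1 - g.1 1 * h.1 0)

theorem vol_rotate (f g h : AffFun) : vol g h f = vol f g h := by
  unfold vol
  ring

theorem vol_swap (f g h : AffFun) : vol g f h = -vol f g h := by
  unfold vol
  ring

theorem vol_sub_smul_neg (f g h : AffFun) (c d : ℝ) :
    vol (f - c • h) (g - d • h) (-h) = -vol f g h := by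
  simp only [vol, Prod.fst_sub, Prod.snd_sub, Prod.smul_fst, Prod.smul_snd, Prod.fst_neg,
    Prod.snd_neg, PiLp.sub_apply, PiLp.smul_apply, PiLp.neg_apply, smul_eq_mul]
  ring

theorem vol_sq_of_add_eq_const {f g h : AffFun} {x y c : ℝ}
    (hfgh : x • f + y • g + h = (0, c)) :
    vol f g h ^ 2 = c ^ 2 * (form f f * form g g - form f g ^ 2) := by
  rw [eq_sub_of_add_eq' hfgh]
  simp only [vol, form, plane_inner_eq, Prod.fst_sub, Prod.snd_sub, Prod.fst_add, Prod.snd_add,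
    Prod.smul_fst, Prod.smul_snd, PiLp.sub_apply, PiLp.add_apply, PiLp.smul_apply,
    PiLp.zero_apply, smul_eq_mul]
  ring

theorem vol_v_sq (S : Seed) {i j k : Fin 3} (hij : i ≠ j) (hik : i ≠ k) (hjk : j ≠ k) :
    vol (S.v i) (S.v j) (S.v k) ^ 2 = vol (S.v 0) (S.v 1) (S.v 2) ^ 2 := by
  refine distinct_induction (P := fun i j k => vol (S.v i) (S.v j) (S.v k) ^ 2 =
    vol (S.v 0) (S.v 1) (S.v 2) ^ 2) rfl ?_ ?_ hij hik hjk
  · intro i j k ih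
    rwa [vol_rotate]
  · intro i j k ih
    rwa [vol_swap, neg_sq]

theorem vol_mutate_sq (Pos : AffFun → Prop) (S : Seed) (k : Fin 3) :
    vol ((S.mutate Pos k).v 0) ((S.mutate Pos k).v 1) ((S.mutate Pos k).v 2) ^ 2 =
      vol (S.v 0) (S.v 1) (S.v 2) ^ 2 := by
  obtain ⟨i, j, hij, hik, hjk⟩ := exists_distinct k
  obtain ⟨c, -, hc, -⟩ := mutateVectors_eq Pos (v := S.v) (B := S.B) k
  have hmut : ∀ i, (S.mutate Pos k).v i = S.v i - c i • S.v k := hc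
  rw [← vol_v_sq _ hij hik hjk, ← vol_v_sq _ hij hik hjk, mutate_v_self, hmut i, hmut j,
    vol_sub_smul_neg, neg_sq]

end Mutation

section Translation

variable {p q w : Plane} {S T : Seed} {i j k : Fin 3} {x : ℝ}

theorem translate_eq_sub (w : Plane) (f : AffFun) : f.translate w = f - (0, inner ℝ f.1 w) :=
  Prod.ext (sub_zero f.1).symm rfl

theorem kernelVec_of_translate {σ : Fin 3 → Fin 3}
    (hv : ∀ m, T.v (σ m) = (S.v m).translate w) (hB : ∀ l m, T.B (σ l) (σ m) = S.B l m)
    (i j k : Fin 3) : kernelVec T (σ i) (σ j) (σ k) = (kernelVec S i j k).translate w := by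
  simp only [kernelVec, hv, hB]
  refine Prod.ext rfl ?_
  simp only [AffFun.translate, Prod.snd_add, Prod.smul_snd, Prod.fst_add, Prod.smul_fst,
    inner_add_left, real_inner_smul_left, smul_eq_mul]
  ring

theorem Coherent.fst_kernelVec_ne_zero (hS : Coherent p q S) : (kernelVec S 0 1 2).1 ≠ 0 := by
  intro h
  have hp := hS.vanishesOn.1
  rw [AffFun.eval, h, inner_zero_left, zero_add] at hp
  have hrel : S.B 1 2 • S.v 0 + S.B 2 0 • S.v 1 + S.B 0 1 • S.v 2 = 0 := by
    rw [← show kernelVec S 0 1 2 = 0 from Prod.ext h hp, kernelVec]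
    abel
  exact hS.ne_zero 1 2 (by decide)
    (eq_zero_of_smul_add_smul_add_smul (by decide) (by decide) (by decide) hrel).1

/-- The kernel vector of `S` is translated to that of `T`, up to sign, and both vanish on the same
line. -/
theorem IsTranslate.exists_eq_smul (hw : IsTranslate w S T) (hpq : p ≠ q) (hS : Coherent p q S)
    (hT : Coherent p q T) : ∃ c : ℝ, w = c • (q - p) := by
  obtain ⟨σ, hv, hB⟩ := hw
  have hker : VanishesOn p q ((kernelVec S 0 1 2).translate w) := by
    rw [← kernelVec_of_translate hv hB, vanishesOn_kernelVec_iff (σ.injective.ne (by decide))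
      (σ.injective.ne (by decide)) (σ.injective.ne (by decide))]
    exact hT.vanishesOn
  have hp : (kernelVec S 0 1 2).eval p - inner ℝ (kernelVec S 0 1 2).1 w = 0 := by
    rw [← hker.1]
    simp only [AffFun.eval, AffFun.translate]
    ring
  rw [hS.vanishesOn.1, zero_sub, neg_eq_zero] at hp
  exact exists_eq_smul_of_inner_eq_zero (sub_ne_zero.2 hpq.symm) hS.fst_kernelVec_ne_zero
    (real_inner_comm (q - p) _ ▸ hS.vanishesOn.2) (real_inner_comm w _ ▸ hp)

theorem snd_mem_span_of_isTranslate {A : Subalgebra ℤ ℝ} {f : AffFun} (hw : IsTranslate w S T)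
    (hST : Submodule.span A (Set.range S.v) = Submodule.span A (Set.range T.v))
    (hf : f ∈ Submodule.span A (Set.range S.v)) :
    ((0, inner ℝ f.1 w) : AffFun) ∈ Submodule.span A (Set.range S.v) := by
  obtain ⟨σ, hv, -⟩ := hw
  induction hf using Submodule.span_induction with
  | mem f hf =>
    obtain ⟨i, rfl⟩ := hf
    rw [← sub_sub_cancel (S.v i) (0, inner ℝ (S.v i).1 w), ← translate_eq_sub, ← hv]
    refine Submodule.sub_mem _ (Submodule.subset_span ⟨i, rfl⟩) ?_
    rw [hST]
    exact Submodule.subset_span ⟨σ i, rfl⟩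
  | zero =>
    rw [Prod.fst_zero, inner_zero_left]
    exact Submodule.zero_mem _
  | add f g _ _ hf hg =>
    convert Submodule.add_mem _ hf hg using 1
    simp [inner_add_left]
  | smul c f _ hf =>
    convert Submodule.smul_mem _ c hf using 1
    refine Prod.ext (smul_zero c).symm ?_
    exact real_inner_smul_left f.1 w (c : ℝ)

theorem isTranslate_of_swap (hij : i ≠ j) (hik : i ≠ k) (hjk : j ≠ k)
    (hi : T.v j = (S.v i).translate w) (hj : T.v i = (S.v j).translate w)
    (hk : T.v k = (S.v k).translate w) (hBij : T.B j i = S.B i j) (hBjk : T.B i k = S.B j k)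
    (hBki : T.B k j = S.B k i) : IsTranslate w S T := by
  have hdiag : ∀ (R : Seed) m, R.B m m = 0 := fun R m => self_eq_neg.1 (R.B_skew m m)
  have hBji : T.B i j = S.B j i := by rw [T.B_skew j i, S.B_skew i j, hBij]
  have hBkj : T.B k i = S.B k j := by rw [T.B_skew i k, S.B_skew j k, hBjk]
  have hBik : T.B j k = S.B i k := by rw [T.B_skew k j, S.B_skew k i, hBki]
  have hswap : Equiv.swap i j k = k := Equiv.swap_apply_of_ne_of_ne hik.symm hjk.symm
  refine ⟨Equiv.swap i j, fun m => ?_, fun l m => ?_⟩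
  · rcases eq_or_eq_or_eq hij hik hjk m with rfl | rfl | rfl <;>
      simpa only [Equiv.swap_apply_left, Equiv.swap_apply_right, hswap]
  · rcases eq_or_eq_or_eq hij hik hjk l with rfl | rfl | rfl <;>
      rcases eq_or_eq_or_eq hij hik hjk m with rfl | rfl | rfl <;>
      simp only [Equiv.swap_apply_left, Equiv.swap_apply_right, *]

end Translation

section ParallelSeeds

variable {p q : Plane} {S : Seed} {i j k : Fin 3} {x : ℝ}

theorem beltSign_mul_inner_neg {f : AffFun} (h : inner ℝ f.1 (q - p) ≠ 0) :
    beltSign p q f * inner ℝ f.1 (q - p) < 0 := by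
  rcases h.lt_or_gt with h | h
  · rwa [beltSign_of_isPositive (isPositive_of_inner_neg h), one_mul]
  · have hneg : IsPositive p q (-f) := isPositive_of_inner_neg <| by
      rwa [Prod.fst_neg, inner_neg_left, neg_lt_zero]
    rw [beltSign_of_not_isPositive fun hf => hf.not_neg hneg]
    linarith

theorem beltSign_eq_mul_of_fst_eq_smul {f g : AffFun} {t : ℝ} (ht : t ^ 2 = 1)
    (hfg : g.1 = t • f.1) (hf : inner ℝ f.1 (q - p) ≠ 0) :
    beltSign p q g = t * beltSign p q f := by
  have hg : inner ℝ g.1 (q - p) = t * inner ℝ f.1 (q - p) := by rw [hfg, real_inner_smul_left]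
  have ht0 : t ≠ 0 := fun h => by simp [h] at ht
  have hneg := beltSign_mul_inner_neg hf
  have hneg' := beltSign_mul_inner_neg (p := p) (q := q) (f := g) (hg ▸ mul_ne_zero ht0 hf)
  rw [hg] at hneg'
  rcases sq_eq_one_iff.1 ht with rfl | rfl <;> rcases beltSign_eq_or p q f with h | h <;>
    rcases beltSign_eq_or p q g with h' | h' <;> rw [h] at hneg ⊢ <;> rw [h'] at hneg' ⊢ <;>
    linarith

theorem form_v_sq (S : Seed) (hij : i ≠ j) : form (S.v i) (S.v j) ^ 2 = S.B i j ^ 2 :=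
  (sq_eq_sq_iff_abs_eq_abs _ _).2 (S.realisation.abs_form i j hij)

theorem Coherent.inner_ne_zero_of_parallel (hS : Coherent p q S) (hpq : p ≠ q) (hij : i ≠ j)
    (hik : i ≠ k) (hjk : j ≠ k) (hx2 : S.B k i ^ 2 < 4) (hBij : S.B i j ≠ 0) {t : ℝ}
    (ht : (S.v j).1 = t • (S.v i).1) : inner ℝ (S.v i).1 (q - p) ≠ 0 := by
  intro hi
  have hj : inner ℝ (S.v j).1 (q - p) = 0 := by rw [ht, real_inner_smul_left, hi, mul_zero]
  have hk : inner ℝ (S.v k).1 (q - p) = 0 := by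
    have hker := ((vanishesOn_kernelVec_iff hij hik hjk).2 hS.vanishesOn).2
    simp only [kernelVec, Prod.fst_add, Prod.smul_fst, inner_add_left, real_inner_smul_left, hi,
      hj, mul_zero, add_zero] at hker
    exact (mul_eq_zero.1 hker).resolve_left hBij
  obtain ⟨c, hc⟩ := exists_eq_smul_of_inner_eq_zero (fst_v_ne_zero S k)
    (sub_ne_zero.2 hpq.symm) hk hi
  have hii := S.realisation.form_self i
  have hkk := S.realisation.form_self k
  have hki := form_v_sq S hik.symm
  simp only [form, hc, real_inner_smul_left, real_inner_smul_right] at hii hkk hki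
  rw [hkk] at hii hki
  nlinarith

/-- The lines of `v i` and `v j` are parallel. As both of them meet the belt line, their signs are
determined by their directions. -/
theorem Coherent.form_and_beltSign_of_parallel (hS : Coherent p q S) (hpq : p ≠ q) (hij : i ≠ j)
    (hik : i ≠ k) (hjk : j ≠ k) (hx2 : S.B k i ^ 2 < 4) (hBij : S.B i j = 2) :
    form (S.v i) (S.v j) = -2 ∧ beltSign p q (S.v i) = 1 := by
  obtain ⟨t, ht, hform⟩ : ∃ t : ℝ, t ^ 2 = 1 ∧ form (S.v i) (S.v j) = 2 * t := by
    refine ⟨form (S.v i) (S.v j) / 2, ?_, by ring⟩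
    rw [div_pow, form_v_sq S hij, hBij]
    norm_num
  have hfst := fst_eq_smul_of_form_eq ht (S.realisation.form_self i) (S.realisation.form_self j)
    hform
  have hsign := beltSign_eq_mul_of_fst_eq_smul ht hfst
    (hS.inner_ne_zero_of_parallel hpq hij hik hjk hx2 (hBij ▸ two_ne_zero) hfst)
  have hcoh := hS.form_eq i j hij
  rw [hform, hsign, hBij] at hcoh
  rw [hform]
  rcases sq_eq_one_iff.1 ht with rfl | rfl
  · rw [one_mul, signedWeight_self _ (beltSign_sq p q _)] at hcoh
    norm_num at hcoh
  · rw [neg_one_mul, signedWeight_neg_right _ (beltSign_sq p q _)] at hcoh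
    exact ⟨by norm_num, by linarith⟩

theorem Coherent.isTranslate_mutate (hS : Coherent p q S) (hij : i ≠ j) (hik : i ≠ k)
    (hjk : j ≠ k) (hx : 0 < x) (hBij : S.B i j = 2) (hBjk : S.B j k = x) (hBki : S.B k i = x)
    (hsign : beltSign p q (S.v i) = 1) {w : Plane} {c : ℝ} (hc : S.v i + S.v j = (0, c))
    (hwi : inner ℝ (S.v i).1 w = -c) (hwk : inner ℝ (S.v k).1 w = 0) :
    IsTranslate w S (S.mutate (IsPositive p q) i) := by
  have hBji : S.B j i = -2 := by rw [S.B_skew i j, hBij]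
  have hBik : S.B i k = -x := by rw [S.B_skew k i, hBki]
  have hBkj : S.B k j = -x := by rw [S.B_skew j k, hBjk]
  have hwj : inner ℝ (S.v j).1 w = c := by
    rw [eq_neg_of_add_eq_zero_right (congrArg Prod.fst hc), inner_neg_left, hwi, neg_neg]
  refine isTranslate_of_swap hij hik hjk ?_ ?_ ?_ ?_ ?_ ?_
  · rw [hS.mutate_v hij.symm, hsign, hBji, translate_eq_sub, hwi,
      show ((0, -c) : AffFun) = -(0, c) by rw [Prod.neg_mk, neg_zero], ← hc]
    norm_num
    module
  · rw [mutate_v_self, translate_eq_sub, hwj, ← hc]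
    abel
  · rw [hS.mutate_v hik.symm, hsign, hBki, abs_of_pos hx, translate_eq_sub, hwk,
      Prod.mk_zero_zero, sub_zero, one_mul, sub_self, zero_div, zero_smul, sub_zero]
  · rw [mutate_B_right, hBji, hBij, neg_neg]
  · rw [mutate_B_left, hBik, hBjk, neg_neg]
  · rw [mutate_B_of_ne _ _ hik.symm hij.symm, hBkj, hBki, hBij, abs_of_pos hx]
    norm_num
    ring

/-- In a cyclic seed with weights `2`, `x`, `x`, two of the lines are parallel, and mutation at the
positive one of their vectors is a translation across the strip between them. -/
theorem Coherent.exists_isTranslate (hS : Coherent p q S) (hpq : p ≠ q) (hij : i ≠ j)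
    (hik : i ≠ k) (hjk : j ≠ k) (hx : 0 < x) (hx2 : x ^ 2 < 4) (hBij : S.B i j = 2)
    (hBjk : S.B j k = x) (hBki : S.B k i = x) :
    ∃ w, IsTranslate w S (S.mutate (IsPositive p q) i) ∧
      ‖w‖ ^ 2 * (4 - x ^ 2) ^ 2 = 2 * vol (S.v 0) (S.v 1) (S.v 2) ^ 2 := by
  obtain ⟨hform, hsign⟩ :=
    hS.form_and_beltSign_of_parallel hpq hij hik hjk (hBki ▸ hx2) hBij
  have hii := S.realisation.form_self i
  have hkk := S.realisation.form_self k
  have hik2 : form (S.v i) (S.v k) ^ 2 = x ^ 2 := by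
    rw [form_comm, form_v_sq S hik.symm, hBki]
  have hadd : S.v i + S.v j = (0, (S.v i + S.v j).2) := by
    refine Prod.ext ?_ rfl
    have := fst_eq_smul_of_form_eq (t := -1) (by norm_num) hii (S.realisation.form_self j)
      (by rw [hform]; norm_num)
    rw [Prod.fst_add, this, neg_one_smul, add_neg_cancel]
  have hgram : inner ℝ (S.v i).1 (S.v i).1 * inner ℝ (S.v k).1 (S.v k).1 -
      inner ℝ (S.v i).1 (S.v k).1 ^ 2 = 4 - x ^ 2 := by
    simp only [form] at hii hkk hik2
    rw [hii, hkk, hik2]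
    norm_num
  obtain ⟨w, hwi, hwk⟩ :=
    exists_inner_eq (hgram ▸ (sub_pos.2 hx2).ne') (-(S.v i + S.v j).2) 0
  refine ⟨w, hS.isTranslate_mutate hij hik hjk hx hBij hBjk hBki hsign hadd hwi hwk, ?_⟩
  have hnorm := inner_mul_gram (S.v i).1 (S.v k).1 w w
  rw [hgram, hwi, hwk, show inner ℝ (S.v k).1 (S.v k).1 = (2 : ℝ) from hkk,
    real_inner_self_eq_norm_sq] at hnorm
  rw [← vol_v_sq S hik hij hjk.symm, vol_sq_of_add_eq_const (x := 1) (y := 0)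
    (by rwa [one_smul, zero_smul, add_zero]), hii, hkk, hik2]
  linear_combination (4 - x ^ 2) * hnorm

theorem HasClass.exists_B_eq {n : ℕ} {a : ℤ} (h : HasClass n S i j k a 0) :
    ∃ l m r : Fin 3, l ≠ m ∧ l ≠ r ∧ m ≠ r ∧
      S.B l m = 2 ∧ S.B m r = |weight n a| ∧ S.B r l = |weight n a| := by
  have hprod := h.prod
  have habs : ∀ {l m : Fin 3} {b : ℤ}, l ≠ m → form (S.v l) (S.v m) ^ 2 = weight n b ^ 2 →
      |S.B l m| = |weight n b| := fun hlm hsq => by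
    rw [← S.realisation.abs_form _ _ hlm, (sq_eq_sq_iff_abs_eq_abs _ _).1 hsq]
  have hij := habs h.hij h.sq_left
  have hjk := habs h.hjk h.sq_right
  have hki := habs h.hik.symm h.sq_sum
  rw [add_zero] at hprod hki
  rw [weight_zero, abs_two] at hjk
  have hpos : 0 < form (S.v i) (S.v j) * form (S.v j) (S.v k) * form (S.v k) (S.v i) := by
    rw [hprod, weight_zero]
    nlinarith [sq_pos_of_ne_zero (weight_ne_zero n a)]
  have hcyc := not_not.1 fun hcyc =>
    hpos.not_gt ((form_mul_form_mul_form_neg_iff S h.hij h.hik h.hjk hpos.ne').2 hcyc)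
  rcases hcyc with ⟨c1, c2, c3⟩ | ⟨c1, c2, c3⟩
  · rw [abs_of_pos c1] at hij
    rw [abs_of_pos c2] at hjk
    rw [abs_of_pos c3] at hki
    exact ⟨j, k, i, h.hjk, h.hij.symm, h.hik.symm, hjk, hki, hij⟩
  · rw [abs_of_neg c1, ← S.B_skew] at hij
    rw [abs_of_neg c2, ← S.B_skew] at hjk
    rw [abs_of_neg c3, ← S.B_skew] at hki
    exact ⟨k, j, i, h.hjk.symm, h.hik.symm, h.hij.symm, hjk, hij, hki⟩

end ParallelSeeds

section InitialSeed

/-- The cosine `s` of the base angle of the initial triangle, in terms of which the initial seed has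
the weights `2s`, `2s`, `2 - 4s²`. -/
def baseCos (n : ℕ) : ℝ := Real.cos (n * alpha n)

theorem baseCos_pos (n : ℕ) : 0 < baseCos n := by
  have h := mul_alpha n
  have h0 := alpha_pos n
  have hn : 0 ≤ n * alpha n := by positivity
  exact Real.cos_pos_of_mem_Ioo ⟨by linarith [Real.pi_pos], by linarith⟩

theorem baseCos_le {n : ℕ} (hn : 1 ≤ n) : baseCos n ≤ 1 / 2 := by
  have h := mul_alpha n
  have h0 := alpha_pos n
  have h1 : (1 : ℝ) ≤ n := by exact_mod_cast hn
  rw [baseCos, ← Real.cos_pi_div_three]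
  exact Real.cos_le_cos_of_nonneg_of_le_pi (by linarith [Real.pi_pos]) (by nlinarith)
    (by nlinarith)

theorem sin_sq_mul_alpha (n : ℕ) : Real.sin (n * alpha n) ^ 2 = 1 - baseCos n ^ 2 :=
  Real.sin_sq _

theorem two_cos_alpha_eq (n : ℕ) : 2 * Real.cos (alpha n) = 2 - 4 * baseCos n ^ 2 := by
  have h : alpha n = Real.pi - 2 * (n * alpha n) := by linarith [mul_alpha n]
  conv_lhs => rw [h]
  rw [Real.cos_pi_sub, Real.cos_two_mul, baseCos]
  ring

theorem sin_alpha_eq (n : ℕ) : Real.sin (alpha n) = 2 * Real.sin (n * alpha n) * baseCos n := by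
  have h : alpha n = Real.pi - 2 * (n * alpha n) := by linarith [mul_alpha n]
  conv_lhs => rw [h]
  rw [Real.sin_pi_sub, Real.sin_two_mul, baseCos]

theorem exists_mul_two_baseCos_eq_one {n : ℕ} (hn : 1 ≤ n) :
    ∃ y ∈ cosRing n, y * (2 * baseCos n) = 1 := by
  obtain ⟨y, hy, hsin⟩ := exists_sin_mul_eq (two_cos_alpha_mem n) n
  refine ⟨y, hy, mul_right_cancel₀ (sin_pos_of_lt (n := n) (k := n) hn (by lia)).ne' ?_⟩
  rw [sin_alpha_eq] at hsin
  linear_combination -hsin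

theorem weight_self_sq (n : ℕ) : weight n n ^ 2 = 4 * baseCos n ^ 2 := by
  rw [weight_eq, mul_pow, ← pow_mul, pow_mul', neg_one_sq, one_pow, baseCos]
  ring

theorem weight_self_add_self (n : ℕ) : weight n (n + n) = -(2 - 4 * baseCos n ^ 2) := by
  have h := weight_mul n n n
  rw [← sq, weight_self_sq, add_neg_cancel, weight_zero] at h
  linarith

/-- `f` and `g` are outer normals of length `√2` of the two sides of an angle. -/
theorem form_eq_neg_two_cos {f g : AffFun} {o x y : Plane} (hf : form f f = 2)
    (hg : form g g = 2) (hfo : f.eval o = 0) (hgo : g.eval o = 0) (hfx : f.eval x = 0)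
    (hgy : g.eval y = 0) (hfy : f.eval y < 0) (hgx : g.eval x < 0) :
    form f g = -(2 * Real.cos (EuclideanGeometry.angle x o y)) := by
  rw [← sub_zero (f.eval x), ← hfo, eval_sub_eval, hfo] at hfx
  rw [← sub_zero (f.eval y), ← hfo, eval_sub_eval, hfo] at hfy
  rw [← sub_zero (g.eval x), ← hgo, eval_sub_eval, hgo] at hgx
  rw [← sub_zero (g.eval y), ← hgo, eval_sub_eval, hgo] at hgy
  rw [EuclideanGeometry.angle, vsub_eq_sub, vsub_eq_sub]
  simp only [form] at hf hg ⊢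
  set F := inner ℝ f.1 g.1
  set A := inner ℝ f.1 (y - o)
  set B := inner ℝ g.1 (x - o)
  have hxy : inner ℝ (x - o) (y - o) * (4 - F ^ 2) = -(A * B * F) := by
    have h := inner_mul_gram f.1 g.1 (x - o) (y - o)
    rw [hf, hg, hfx, hgy] at h
    linear_combination h
  have hxx : ‖x - o‖ ^ 2 * (4 - F ^ 2) = 2 * B ^ 2 := by
    have h := inner_mul_gram f.1 g.1 (x - o) (x - o)
    rw [hf, hg, hfx, real_inner_self_eq_norm_sq] at h
    linear_combination h
  have hyy : ‖y - o‖ ^ 2 * (4 - F ^ 2) = 2 * A ^ 2 := by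
    have h := inner_mul_gram f.1 g.1 (y - o) (y - o)
    rw [hf, hg, hgy, real_inner_self_eq_norm_sq] at h
    linear_combination h
  have hAB : 0 < A * B := mul_pos_of_neg_of_neg hfy hgx
  have hgram : 0 < 4 - F ^ 2 :=
    pos_of_mul_pos_right (hxx ▸ mul_pos two_pos (sq_pos_of_neg hgx)) (sq_nonneg _)
  have hnorm : ‖x - o‖ * ‖y - o‖ * (4 - F ^ 2) = 2 * (A * B) := by
    refine (sq_eq_sq₀ (by positivity) (by positivity)).1 ?_
    linear_combination (‖y - o‖ ^ 2 * (4 - F ^ 2)) * hxx + 2 * B ^ 2 * hyy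
  have hcos := InnerProductGeometry.cos_angle_mul_norm_mul_norm (x - o) (y - o)
  refine mul_left_cancel₀ hAB.ne' ?_
  linear_combination hxy + (4 - F ^ 2) * hcos -
    Real.cos (InnerProductGeometry.angle (x - o) (y - o)) * hnorm

variable {n : ℕ} {t : Affine.Triangle ℝ Plane} {S : Seed}

theorem legLength_pos (t : Affine.Triangle ℝ Plane) : 0 < legLength t :=
  dist_pos.2 (t.independent.injective.ne (by decide))

namespace IsInitialSeed

theorem form_eq (hS : IsInitialSeed t S) {i j k : Fin 3} (hij : i ≠ j) (hik : i ≠ k)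
    (hjk : j ≠ k) : form (S.v i) (S.v j) =
      -(2 * Real.cos (EuclideanGeometry.angle (t.points j) (t.points k) (t.points i))) :=
  form_eq_neg_two_cos (S.realisation.form_self i) (S.realisation.form_self j)
    (hS.eval_eq_zero i k hik.symm) (hS.eval_eq_zero j k hjk.symm) (hS.eval_eq_zero i j hij.symm)
    (hS.eval_eq_zero j i hij) (hS.eval_neg i) (hS.eval_neg j)

theorem form_zero_one (hS : IsInitialSeed t S) (ht : IsInitialTriangle n t) :
    form (S.v 0) (S.v 1) = -(2 * baseCos n) := by
  rw [hS.form_eq (k := 2) (by decide) (by decide) (by decide), EuclideanGeometry.angle_comm,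
    ht.angle_two, baseCos]

theorem form_zero_two (hS : IsInitialSeed t S) (ht : IsInitialTriangle n t) :
    form (S.v 0) (S.v 2) = -(2 * baseCos n) := by
  rw [hS.form_eq (k := 1) (by decide) (by decide) (by decide), EuclideanGeometry.angle_comm,
    ht.angle_one, baseCos]

theorem form_one_two (hS : IsInitialSeed t S) (ht : IsInitialTriangle n t) :
    form (S.v 1) (S.v 2) = -(2 - 4 * baseCos n ^ 2) := by
  rw [hS.form_eq (k := 0) (by decide) (by decide) (by decide), EuclideanGeometry.angle_comm,
    ht.angle_zero, two_cos_alpha_eq]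

theorem B_zero_one (hS : IsInitialSeed t S) (ht : IsInitialTriangle n t) :
    S.B 0 1 = 2 * baseCos n := by
  have h := S.realisation.abs_form 0 1 (by decide)
  rwa [hS.form_zero_one ht, abs_neg, abs_of_pos (mul_pos two_pos (baseCos_pos n)),
    abs_of_pos hS.arrow_zero_one, eq_comm] at h

theorem B_zero_two (hS : IsInitialSeed t S) (ht : IsInitialTriangle n t) :
    S.B 0 2 = 2 * baseCos n := by
  have h := S.realisation.abs_form 0 2 (by decide)
  rwa [hS.form_zero_two ht, abs_neg, abs_of_pos (mul_pos two_pos (baseCos_pos n)),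
    abs_of_pos hS.arrow_zero_two, eq_comm] at h

theorem B_one_two (hS : IsInitialSeed t S) (ht : IsInitialTriangle n t) (hn : 1 ≤ n) :
    S.B 1 2 = 2 - 4 * baseCos n ^ 2 := by
  have h := S.realisation.abs_form 1 2 (by decide)
  have hpos : 0 < 2 - 4 * baseCos n ^ 2 := by nlinarith [baseCos_pos n, baseCos_le hn]
  rwa [hS.form_one_two ht, abs_neg, abs_of_pos hpos, abs_of_pos hS.arrow_one_two, eq_comm] at h

theorem hasClass (hS : IsInitialSeed t S) (ht : IsInitialTriangle n t) :
    HasClass n S 1 0 2 n n := by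
  have h10 : form (S.v 1) (S.v 0) = -(2 * baseCos n) := by rw [form_comm, hS.form_zero_one ht]
  have h21 : form (S.v 2) (S.v 1) = weight n (n + n) := by
    rw [form_comm, hS.form_one_two ht, weight_self_add_self]
  refine ⟨by decide, by decide, by decide, ?_, ?_, by rw [h21], ?_⟩
  · rw [h10, weight_self_sq]
    ring
  · rw [hS.form_zero_two ht, weight_self_sq]
    ring
  · rw [h10, hS.form_zero_two ht, h21, ← sq (weight n n), weight_self_sq]
    ring

theorem smul_add_fst_eq_zero (hS : IsInitialSeed t S) (ht : IsInitialTriangle n t) :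
    (2 * baseCos n) • (S.v 0).1 + (S.v 1).1 + (S.v 2).1 = 0 := by
  have h01 := hS.form_zero_one ht
  have h02 := hS.form_zero_two ht
  have h12 := hS.form_one_two ht
  have hself := S.realisation.form_self
  simp only [form] at h01 h02 h12 hself
  rw [← inner_self_eq_zero (𝕜 := ℝ)]
  simp only [inner_add_left, inner_add_right, real_inner_smul_left, real_inner_smul_right,
    real_inner_comm (S.v 0).1 (S.v 1).1, real_inner_comm (S.v 0).1 (S.v 2).1,
    real_inner_comm (S.v 1).1 (S.v 2).1, h01, h02, h12, hself]
  ring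

/-- At the apex the sum has the value `2s` times that of `S.v 0`. -/
theorem smul_add_eq_const (hS : IsInitialSeed t S) (ht : IsInitialTriangle n t) :
    (2 * baseCos n) • S.v 0 + (1 : ℝ) • S.v 1 + S.v 2 =
      (0, 2 * baseCos n * (S.v 0).eval (t.points 0)) := by
  have hfst : ((2 * baseCos n) • S.v 0 + (1 : ℝ) • S.v 1 + S.v 2).1 = 0 := by
    rw [one_smul]
    exact hS.smul_add_fst_eq_zero ht
  refine Prod.ext hfst ?_
  have heval : ((2 * baseCos n) • S.v 0 + (1 : ℝ) • S.v 1 + S.v 2).eval (t.points 0) =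
      2 * baseCos n * (S.v 0).eval (t.points 0) := by
    rw [eval_add, eval_add, eval_smul, eval_smul, hS.eval_eq_zero 1 0 (by decide),
      hS.eval_eq_zero 2 0 (by decide), mul_zero, add_zero, add_zero]
  rwa [AffFun.eval, hfst, inner_zero_left, zero_add] at heval

theorem eval_two_points_two (hS : IsInitialSeed t S) (ht : IsInitialTriangle n t) :
    (S.v 2).eval (t.points 2) = 2 * baseCos n * (S.v 0).eval (t.points 0) := by
  have h := congrArg (fun f : AffFun => f.eval (t.points 2)) (hS.smul_add_eq_const ht)
  simp only [eval_add, eval_smul, hS.eval_eq_zero 0 2 (by decide),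
    hS.eval_eq_zero 1 2 (by decide), mul_zero, zero_add] at h
  rw [h, AffFun.eval, inner_zero_left, zero_add]

theorem eval_points_zero_sq (hS : IsInitialSeed t S) (ht : IsInitialTriangle n t) :
    (S.v 0).eval (t.points 0) ^ 2 = 2 * legLength t ^ 2 * (1 - baseCos n ^ 2) := by
  have hleg : legLength t = ‖t.points 1 - t.points 0‖ := by
    rw [legLength, dist_comm, dist_eq_norm]
  have h := inner_mul_gram (S.v 0).1 (S.v 2).1 (t.points 1 - t.points 0)
    (t.points 1 - t.points 0)
  have h00 := S.realisation.form_self 0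
  have h22 := S.realisation.form_self 2
  have h02 := hS.form_zero_two ht
  simp only [form] at h00 h22 h02
  rw [real_inner_self_eq_norm_sq (t.points 1 - t.points 0), ← hleg, ← eval_sub_eval,
    ← eval_sub_eval, hS.eval_eq_zero 0 1 (by decide), hS.eval_eq_zero 2 1 (by decide),
    hS.eval_eq_zero 2 0 (by decide), h00, h22, h02] at h
  linear_combination -(1 / 2) * h

theorem vol_sq (hS : IsInitialSeed t S) (ht : IsInitialTriangle n t) :
    vol (S.v 0) (S.v 1) (S.v 2) ^ 2 =
      32 * (baseCos n * (1 - baseCos n ^ 2) * legLength t) ^ 2 := by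
  rw [vol_sq_of_add_eq_const (hS.smul_add_eq_const ht), S.realisation.form_self,
    S.realisation.form_self, hS.form_zero_one ht]
  linear_combination (2 * baseCos n) ^ 2 * (4 - 4 * baseCos n ^ 2) * hS.eval_points_zero_sq ht

theorem eval_altitudeFoot_self (hS : IsInitialSeed t S) (i : Fin 3) :
    (S.v i).eval (t.altitudeFoot i) = 0 := by
  refine affineSpan_induction (p := fun x => (S.v i).eval x = 0)
    (t.altitudeFoot_mem_affineSpan_image_compl i) ?_ ?_
  · rintro _ ⟨j, hj, rfl⟩
    exact hS.eval_eq_zero i j hj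
  · intro c u v w hu hv hw
    have h : (S.v i).eval (c • (u -ᵥ v) +ᵥ w) = c * ((S.v i).eval u - (S.v i).eval v) +
        (S.v i).eval w := by
      simp only [AffFun.eval, vsub_eq_sub, vadd_eq_add, inner_add_right, real_inner_smul_right,
        inner_sub_right]
      ring
    rw [h, hu, hv, hw, sub_zero, mul_zero, zero_add]

theorem exists_altitudeFoot_sub_eq_smul (hS : IsInitialSeed t S) (i : Fin 3) :
    ∃ c : ℝ, t.altitudeFoot i - t.points i = c • (S.v i).1 := by
  obtain ⟨l, m, hlm, hli, hmi⟩ := exists_distinct i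
  have hfoot : inner ℝ (t.altitudeFoot i - t.points i) (t.points l - t.points m) = 0 := by
    have hl := t.inner_vsub_altitudeFoot_vsub_altitudeFoot_eq_zero hli.symm
    have hm := t.inner_vsub_altitudeFoot_vsub_altitudeFoot_eq_zero hmi.symm
    simp only [vsub_eq_sub] at hl hm
    rw [real_inner_comm, ← sub_sub_sub_cancel_right _ _ (t.altitudeFoot i), ← neg_sub (t.points i),
      inner_neg_right, inner_sub_left, hl, hm, sub_zero, neg_zero]
  refine exists_eq_smul_of_inner_eq_zero (fst_v_ne_zero S i)
    (sub_ne_zero.2 (t.independent.injective.ne hlm)) ?_ hfoot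
  rw [← eval_sub_eval, hS.eval_eq_zero i l hli, hS.eval_eq_zero i m hmi, sub_zero]

theorem eval_altitudeFoot (hS : IsInitialSeed t S) {i l : Fin 3} (hil : i ≠ l) :
    (S.v l).eval (t.altitudeFoot i) = -((S.v i).eval (t.points i) / 2) * form (S.v l) (S.v i) := by
  obtain ⟨c, hc⟩ := hS.exists_altitudeFoot_sub_eq_smul i
  have hi := eval_sub_eval (S.v i) (t.altitudeFoot i) (t.points i)
  have hl := eval_sub_eval (S.v l) (t.altitudeFoot i) (t.points i)
  have hself : inner ℝ (S.v i).1 (S.v i).1 = (2 : ℝ) := S.realisation.form_self i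
  rw [hS.eval_altitudeFoot_self, hc, real_inner_smul_right, hself] at hi
  rw [hS.eval_eq_zero l i hil, hc, real_inner_smul_right, sub_zero] at hl
  rw [hl, form]
  linear_combination (-(1 / 2) * inner ℝ (S.v l).1 (S.v i).1) * hi

end IsInitialSeed

end InitialSeed

section Belt

variable {n : ℕ} {t : Affine.Triangle ℝ Plane} {S : Seed}

namespace IsInitialSeed

theorem eval_one_altitudeFoot_zero (hS : IsInitialSeed t S) (ht : IsInitialTriangle n t) :
    (S.v 1).eval (t.altitudeFoot 0) = baseCos n * (S.v 0).eval (t.points 0) := by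
  rw [hS.eval_altitudeFoot (by decide), form_comm, hS.form_zero_one ht]
  ring

theorem inner_zero_belt (hS : IsInitialSeed t S) (ht : IsInitialTriangle n t) :
    inner ℝ (S.v 0).1 (t.altitudeFoot 2 - t.altitudeFoot 0) =
      2 * baseCos n ^ 2 * (S.v 0).eval (t.points 0) := by
  rw [← eval_sub_eval, hS.eval_altitudeFoot_self, hS.eval_altitudeFoot (by decide),
    hS.form_zero_two ht, hS.eval_two_points_two ht]
  ring

theorem inner_one_belt (hS : IsInitialSeed t S) (ht : IsInitialTriangle n t) :
    inner ℝ (S.v 1).1 (t.altitudeFoot 2 - t.altitudeFoot 0) =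
      baseCos n * (1 - 4 * baseCos n ^ 2) * (S.v 0).eval (t.points 0) := by
  rw [← eval_sub_eval, hS.eval_one_altitudeFoot_zero ht, hS.eval_altitudeFoot (by decide),
    hS.form_one_two ht, hS.eval_two_points_two ht]
  ring

theorem inner_two_belt (hS : IsInitialSeed t S) (ht : IsInitialTriangle n t) :
    inner ℝ (S.v 2).1 (t.altitudeFoot 2 - t.altitudeFoot 0) =
      -(baseCos n * (S.v 0).eval (t.points 0)) := by
  rw [← eval_sub_eval, hS.eval_altitudeFoot_self, hS.eval_altitudeFoot (by decide), form_comm,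
    hS.form_zero_two ht]
  ring

theorem altitudeFoot_ne (hS : IsInitialSeed t S) (ht : IsInitialTriangle n t) :
    t.altitudeFoot 0 ≠ t.altitudeFoot 2 := by
  intro h
  have hinner := hS.inner_two_belt ht
  rw [h, sub_self, inner_zero_right] at hinner
  exact mul_ne_zero (baseCos_pos n).ne' (hS.eval_neg 0).ne (neg_eq_zero.1 hinner.symm)

theorem norm_belt (hS : IsInitialSeed t S) (ht : IsInitialTriangle n t) (hn : 1 ≤ n) :
    ‖t.altitudeFoot 2 - t.altitudeFoot 0‖ = baseCos n * legLength t := by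
  have hs := baseCos_pos n
  have hs' : 1 - baseCos n ^ 2 ≠ 0 := by nlinarith [baseCos_le hn]
  have h := inner_mul_gram (S.v 0).1 (S.v 2).1 (t.altitudeFoot 2 - t.altitudeFoot 0)
    (t.altitudeFoot 2 - t.altitudeFoot 0)
  have h00 := S.realisation.form_self 0
  have h22 := S.realisation.form_self 2
  have h02 := hS.form_zero_two ht
  simp only [form] at h00 h22 h02
  rw [real_inner_self_eq_norm_sq (t.altitudeFoot 2 - t.altitudeFoot 0), hS.inner_zero_belt ht,
    hS.inner_two_belt ht, h00, h22, h02] at h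
  refine (sq_eq_sq₀ (norm_nonneg _) (mul_pos hs (legLength_pos t)).le).1 (mul_left_cancel₀ hs' ?_)
  linear_combination (1 / 4) * h + (1 / 2) * baseCos n ^ 2 * hS.eval_points_zero_sq ht

theorem beltPositive_zero (hS : IsInitialSeed t S) (ht : IsInitialTriangle n t) :
    BeltPositive t (S.v 0) := by
  refine isPositive_of_inner_neg ?_
  rw [hS.inner_zero_belt ht]
  exact mul_neg_of_pos_of_neg (mul_pos two_pos (pow_pos (baseCos_pos n) 2)) (hS.eval_neg 0)

/-- For `n = 1` the line of `S.v 1` is parallel to the belt line. -/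
theorem beltPositive_one (hS : IsInitialSeed t S) (ht : IsInitialTriangle n t) (hn : 1 ≤ n) :
    BeltPositive t (S.v 1) := by
  have hs := baseCos_pos n
  have he := hS.eval_neg 0
  have hle : inner ℝ (S.v 1).1 (t.altitudeFoot 2 - t.altitudeFoot 0) ≤ 0 := by
    rw [hS.inner_one_belt ht]
    exact mul_nonpos_of_nonneg_of_nonpos
      (mul_nonneg hs.le (by nlinarith [baseCos_le hn])) he.le
  rcases hle.lt_or_eq with h | h
  · exact isPositive_of_inner_neg h
  · refine isPositive_of_inner_eq_zero h ?_
    rw [hS.eval_one_altitudeFoot_zero ht]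
    exact mul_neg_of_pos_of_neg hs he

theorem not_beltPositive_two (hS : IsInitialSeed t S) (ht : IsInitialTriangle n t) :
    ¬ BeltPositive t (S.v 2) := by
  refine fun h => IsPositive.not_neg h (isPositive_of_inner_neg ?_)
  rw [Prod.fst_neg, inner_neg_left, hS.inner_two_belt ht, neg_neg]
  exact mul_neg_of_pos_of_neg (baseCos_pos n) (hS.eval_neg 0)

theorem vanishesOn_kernelVec (hS : IsInitialSeed t S) (ht : IsInitialTriangle n t)
    (hn : 1 ≤ n) : VanishesOn (t.altitudeFoot 0) (t.altitudeFoot 2) (kernelVec S 0 1 2) := by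
  constructor
  · rw [kernelVec, eval_add, eval_add, eval_smul, eval_smul, eval_smul, S.B_skew 0 2,
      hS.B_zero_one ht, hS.B_zero_two ht, hS.eval_altitudeFoot_self,
      hS.eval_one_altitudeFoot_zero ht, hS.eval_altitudeFoot (by decide), form_comm,
      hS.form_zero_two ht]
    ring
  · simp only [kernelVec, Prod.fst_add, Prod.smul_fst, inner_add_left, real_inner_smul_left]
    rw [hS.inner_zero_belt ht, hS.inner_one_belt ht, hS.inner_two_belt ht, S.B_skew 0 2,
      hS.B_zero_one ht, hS.B_zero_two ht, hS.B_one_two ht hn]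
    ring

theorem coherent (hS : IsInitialSeed t S) (ht : IsInitialTriangle n t) (hn : 1 ≤ n) :
    Coherent (t.altitudeFoot 0) (t.altitudeFoot 2) S := by
  refine Coherent.of_form_eq (hS.altitudeFoot_ne ht) (fun i j => (hS.hasClass ht).B_ne_zero)
    (hS.vanishesOn_kernelVec ht hn) 0 fun i hi => ?_
  have h0 := beltSign_of_isPositive (hS.beltPositive_zero ht)
  have h1 := beltSign_of_isPositive (hS.beltPositive_one ht hn)
  have h2 := beltSign_of_not_isPositive (hS.not_beltPositive_two ht)
  fin_cases i
  · exact absurd rfl hi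
  · refine form_eq_signedWeight_symm (i := 0) (j := 1) ?_
    rw [h0, h1, signedWeight_self _ (one_pow 2), hS.form_zero_one ht, hS.B_zero_one ht,
      abs_of_pos (mul_pos two_pos (baseCos_pos n))]
  · refine form_eq_signedWeight_symm (i := 0) (j := 2) ?_
    rw [h0, h2, signedWeight_neg_right _ (one_pow 2), hS.form_zero_two ht, hS.B_zero_two ht,
      mul_one]

end IsInitialSeed

end Belt

section Lattices

variable {n : ℕ} {p q w : Plane} {S₀ S T : Seed} {i j k : Fin 3} {a b : ℤ}

/-- The properties which the vertices of the exchange graph of `S₀` share with `S₀`. -/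
structure Invariants (n : ℕ) (p q : Plane) (S₀ S : Seed) : Prop where
  coherent : Coherent p q S
  hasClass : ∃ i j k a b, HasClass n S i j k a b
  span_eq : Submodule.span (cosRing n) (Set.range S.v) =
    Submodule.span (cosRing n) (Set.range S₀.v)
  vol_sq_eq : vol (S.v 0) (S.v 1) (S.v 2) ^ 2 = vol (S₀.v 0) (S₀.v 1) (S₀.v 2) ^ 2

theorem Invariants.mutate (h : Invariants n p q S₀ S) (hpq : p ≠ q) (k : Fin 3) :
    Invariants n p q S₀ (S.mutate (IsPositive p q) k) := by
  obtain ⟨_, _, _, _, _, hS⟩ := h.hasClass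
  obtain ⟨i, j, l, a, b, hmut⟩ := hS.exists_mutate (Pos := IsPositive p q) k
  exact ⟨h.coherent.mutate hpq k fun _ _ => hmut.B_ne_zero, ⟨i, j, l, a, b, hmut⟩,
    (span_mutate _ _ S k fun _ => hS.form_mem).trans h.span_eq,
    (vol_mutate_sq _ S k).trans h.vol_sq_eq⟩

theorem Invariants.of_inExchangeGraph (hpq : p ≠ q) (hS₀ : Coherent p q S₀)
    (hc : HasClass n S₀ i j k a b) (hS : InExchangeGraph (IsPositive p q) S₀ S) :
    Invariants n p q S₀ S := by
  induction hS with
  | refl => exact ⟨hS₀, ⟨i, j, k, a, b, hc⟩, rfl, rfl⟩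
  | tail _ hstep ih =>
    obtain ⟨m, rfl⟩ := hstep
    exact ih.mutate hpq m

theorem weight_sq_eq (n k : ℕ) : weight n k ^ 2 = 4 - 4 * Real.sin (k * alpha n) ^ 2 := by
  rw [weight_eq, mul_pow, ← pow_mul, pow_mul', neg_one_sq, one_pow, Real.sin_sq]
  ring

variable {t : Affine.Triangle ℝ Plane}

namespace IsInitialSeed

theorem invariants (hS₀ : IsInitialSeed t S₀) (ht : IsInitialTriangle n t) (hn : 1 ≤ n)
    (hS : InExchangeGraph (BeltPositive t) S₀ S) :
    Invariants n (t.altitudeFoot 0) (t.altitudeFoot 2) S₀ S :=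
  Invariants.of_inExchangeGraph (hS₀.altitudeFoot_ne ht) (hS₀.coherent ht hn) (hS₀.hasClass ht) hS

theorem exists_eval_eq_mul {A : Subalgebra ℤ ℝ} (hS : IsInitialSeed t S) {f : AffFun}
    (hf : f ∈ Submodule.span A (Set.range S.v)) :
    ∃ x ∈ A, f.eval (t.points 0) = x * (S.v 0).eval (t.points 0) := by
  obtain ⟨x, rfl⟩ := (Submodule.mem_span_range_iff_exists_fun A).1 hf
  have hsmul : ∀ i, AffFun.eval (x i • S.v i) (t.points 0) = x i * (S.v i).eval (t.points 0) :=
    fun i => eval_smul (x i : ℝ) _ _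
  refine ⟨x 0, (x 0).2, ?_⟩
  rw [Fin.sum_univ_three, eval_add, eval_add, hsmul, hsmul, hsmul,
    hS.eval_eq_zero 1 0 (by decide), hS.eval_eq_zero 2 0 (by decide), mul_zero, mul_zero, add_zero,
    add_zero]

/-- All translations are multiples `c • (q - p)` of one vector, as they preserve the belt line; and
`c` lies in a fractional ideal, as they preserve the `ℤ[2 cos α]`-span of a seed. -/
theorem latticeL_le_cosLattice (hS₀ : IsInitialSeed t S₀) (ht : IsInitialTriangle n t)
    (hn : 1 ≤ n) : latticeL (BeltPositive t) S₀ ≤ cosLattice n (legLength t) := by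
  refine Submodule.span_le.2 ?_
  rintro _ ⟨w, S₁, S₂, h₁, h₂, hw, rfl⟩
  have hS₁ := hS₀.invariants ht hn h₁
  have hS₂ := hS₀.invariants ht hn h₂
  obtain ⟨c, rfl⟩ := hw.exists_eq_smul (hS₀.altitudeFoot_ne ht) hS₂.coherent hS₁.coherent
  have hmem := snd_mem_span_of_isTranslate hw (hS₂.span_eq.trans hS₁.span_eq.symm)
    (f := S₀.v 0) (hS₂.span_eq ▸ Submodule.subset_span ⟨0, rfl⟩)
  obtain ⟨x, hx, hxe⟩ := hS₀.exists_eval_eq_mul (hS₂.span_eq ▸ hmem)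
  rw [AffFun.eval, inner_zero_left, zero_add, real_inner_smul_right, hS₀.inner_zero_belt ht,
    ← mul_assoc] at hxe
  obtain ⟨y, hy, hys⟩ := exists_mul_two_baseCos_eq_one hn
  have hxy : c * baseCos n = x * y := by
    rw [← mul_right_cancel₀ (hS₀.eval_neg 0).ne hxe]
    linear_combination -(c * baseCos n) * hys
  have hnorm : ‖c • (t.altitudeFoot 2 - t.altitudeFoot 0)‖ = legLength t * |x * y| := by
    rw [norm_smul, hS₀.norm_belt ht hn, ← hxy, abs_mul, abs_of_pos (baseCos_pos n),
      Real.norm_eq_abs]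
    ring
  have habs : |x * y| ∈ cosRing n := by
    rcases abs_choice (x * y) with h | h <;> rw [h]
    exacts [mul_mem hx hy, neg_mem (mul_mem hx hy)]
  exact ⟨|x * y|, habs, hnorm.symm⟩

theorem exists_parallel_seed (hS₀ : IsInitialSeed t S₀) (ht : IsInitialTriangle n t) {k : ℕ}
    (hk : Nat.gcd k (2 * n + 1) = 1) :
    ∃ S, InExchangeGraph (BeltPositive t) S₀ S ∧ ∃ i j l : Fin 3, i ≠ j ∧ i ≠ l ∧ j ≠ l ∧
      S.B i j = 2 ∧ S.B j l = |weight n k| ∧ S.B l i = |weight n k| := by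
  have h : Reachable n (BeltPositive t) S₀ n n :=
    ⟨S₀, 1, 0, 2, Relation.ReflTransGen.refl, hS₀.hasClass ht⟩
  obtain ⟨S, i, j, l, hS, hc⟩ := (sub_self (n : ℤ) ▸ h.sub_right).of_coprime (by simp) hk
  exact ⟨S, hS, hc.exists_B_eq⟩

theorem latticeR_le_latticeL (hS₀ : IsInitialSeed t S₀) (ht : IsInitialTriangle n t)
    (hn : 1 ≤ n) : latticeR n (legLength t) ≤ latticeL (BeltPositive t) S₀ := by
  refine Submodule.span_le.2 ?_
  rintro _ ⟨k, hk, hkn, hcop, rfl⟩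
  obtain ⟨S, hS, i, j, l, hij, hil, hjl, hBij, hBjl, hBli⟩ := hS₀.exists_parallel_seed ht hcop
  have hinv := hS₀.invariants ht hn hS
  have hsink := sin_pos_of_lt hk (show k < 2 * n + 1 by lia)
  have hweight : |weight n k| ^ 2 = 4 - 4 * Real.sin (k * alpha n) ^ 2 := by
    rw [sq_abs, weight_sq_eq]
  obtain ⟨w, hw, hnorm⟩ := hinv.coherent.exists_isTranslate (hS₀.altitudeFoot_ne ht) hij hil hjl
    (abs_pos.2 (weight_ne_zero n k)) (by nlinarith) hBij hBjl hBli
  refine Submodule.subset_span ⟨w, _, S, hS.mutate i, hS, hw, ?_⟩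
  rw [hweight, hinv.vol_sq_eq, hS₀.vol_sq ht] at hnorm
  have hsq : (‖w‖ * Real.sin (k * alpha n) ^ 2) ^ 2 =
      (2 * baseCos n * (1 - baseCos n ^ 2) * legLength t) ^ 2 := by
    linear_combination (1 / 16) * hnorm
  have hcos : 0 ≤ 1 - baseCos n ^ 2 := by
    rw [← sin_sq_mul_alpha]
    exact sq_nonneg _
  have hw_norm := (sq_eq_sq₀ (by positivity) (mul_nonneg (mul_nonneg
    (mul_pos two_pos (baseCos_pos n)).le hcos) (legLength_pos t).le)).1 hsq
  rw [← mul_div_assoc, div_eq_iff (pow_pos hsink 2).ne', hw_norm, sin_alpha_eq]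
  linear_combination 2 * baseCos n * legLength t * sin_sq_mul_alpha n

end IsInitialSeed

end Lattices

end RealQuiver

end

theorem proposition5p2 (n : ℕ) (hn : 1 ≤ n) (t : Affine.Triangle ℝ RealQuiver.Plane)
    (ht : RealQuiver.IsInitialTriangle n t) (S₀ : RealQuiver.Seed)
    (hS₀ : RealQuiver.IsInitialSeed t S₀) (d₁ : ℝ) (hd₁ : d₁ = RealQuiver.legLength t)
    (R L Z : Submodule ℤ ℝ) (hR : R = RealQuiver.latticeR n d₁)
    (hL : L = RealQuiver.latticeL (RealQuiver.BeltPositive t) S₀)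
    (hZ : Z = RealQuiver.cosLattice n d₁) :
    (∃ d : ℕ, 0 < d ∧
      R ≤ L ∧ R ≤ Z ∧
      L ≤ RealQuiver.cosLattice n ((1 / (d : ℝ)) * d₁) ∧
      Z ≤ RealQuiver.cosLattice n ((1 / (d : ℝ)) * d₁) ∧
      Module.finrank ℤ (RealQuiver.cosLattice n ((1 / (d : ℝ)) * d₁)) =
        Nat.totient (2 * n + 1) / 2) ∧
    Module.finrank ℤ R = Nat.totient (2 * n + 1) / 2 ∧
    Module.finrank ℤ L = Nat.totient (2 * n + 1) / 2 ∧
    Module.finrank ℤ Z = Nat.totient (2 * n + 1) / 2 := by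
  subst hR hL hZ hd₁
  have hd := (RealQuiver.legLength_pos t).ne'
  have hRZ := RealQuiver.latticeR_le_cosLattice n hn (RealQuiver.legLength t)
  have hRL := hS₀.latticeR_le_latticeL ht hn
  have hLZ := hS₀.latticeL_le_cosLattice ht hn
  have rank := @RealQuiver.finrank_of_latticeR_le n hn _ hd
  refine ⟨⟨1, one_pos, ?_⟩, rank le_rfl hRZ, rank hRL hLZ, rank hRZ le_rfl⟩
  rw [Nat.cast_one, div_one, one_mul]
  exact ⟨hRL, hRZ, hLZ, le_rfl, rank hRZ le_rfl⟩
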